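/- **Definitions.** A $k$-CNF is an ordered sequence of clauses, each with at most $k$ literals; it is a $Q$-clause $k$-CNF if it has at most $Q$ clauses. A restriction is an element $\rho\in\{0,1,\ast\}^n$, and $F\upharpoonright\rho$ is $F$ with the values fixed by $\rho$ substituted. The canonical decision tree $\mathrm{CDT}(F)$ is the constant $0$ if some clause of $F$ is identically $0$, and the constant $1$ if all clauses are identically $1$. Otherwise it exhaustively queries all variables of the first clause that is not identically $1$, and each resulting leaf, with $\eta$ the assignment on its path, is replaced by $\mathrm{CDT}(F\upharpoonright\eta)$. A path from the root of $\mathrm{CDT}(F)$ is *full* if it ends at the end of such a block of queries. For an ordered list $\mathscr F=(F_1,\dots,F_M)$ of $k$-CNFs, the set of trees $\mathrm{CCDT}_\ell(\mathscr F)$ is defined inductively. If $M=0$, it contains only the empty tree. If $\mathrm{depth}(\mathrm{CDT}(F_1))\le\ell$, it is $\mathrm{CCDT}_\ell(F_2,\dots,F_M)$. Otherwise it consists of all trees obtained by choosing a full path $\eta$ in $\mathrm{CDT}(F_1)$ with $\ell+1\le|\eta|\le\ell+k$, exhaustively querying the variables of $\eta$, and attaching at the end of each resulting path $\pi$ some tree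 from $\mathrm{CCDT}_\ell(\mathscr F\upharpoonright\pi)$. Write $\mathrm{depth}(\mathrm{CCDT}_\ell(\mathscr F))$ for the maximum depth of a tree in this set. For $(\varrho,y)\in\{0,1\}^{n\times q}\times\{0,1\}^n=\{0,1\}^{Y_q}$, let $\rho(\varrho,y)_i=\ast$ if $\varrho_{i,1}=\dots=\varrho_{i,q}=1$, and $\rho(\varrho,y)_i=y_i$ otherwise. A depth-$3$ circuit has unbounded fan-in AND and OR gates over literals and depth at most $3$; its size is the number of its gates plus the number of its input variables. A distribution $\mathcal D$ on $\{0,1\}^{Y_q}$ $\varepsilon$-fools a class of Boolean functions if $|\mathbf E_{\mathcal D}[f]-\mathbf E_{\mathcal U}[f]|\le\varepsilon$ for each $f$ in the class, where $\mathcal U$ is the uniform distribution. **Theorem (pseudorandom multi-switching lemma).** There are absolute constants $c_1,c_2,c_3\in\mathbb N$ such that the following holds. Let $\mathscr F=(F_1,\dots,F_M)$ be an ordered list of $Q$-clause $k$-CNFs over $n$ variables. Let $\delta,p\in(0,1)$ be such that $q=\log_2(1/p)$ is an integer, let $\ell\ge\max(k,1)$, and let $t\in\mathbb N$. Let $\mathcal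 D$ be any distribution on $\{0,1\}^{Y_q}$ that $\bigl(\delta/(M^{\lceil t/\ell\rceil}n^{c_1t})\bigr)$-fools the class of depth-$3$ circuits of size at most $M\bigl(n^{c_2\ell}+Q\,2^{c_3kq}\bigr)$ over the variables $Y_q$ (if $M$ or $n$ is $0$, a quotient with denominator $0$ is read as $0$). Then $$\Pr_{(\varrho,y)\leftarrow\mathcal D}\bigl[\mathrm{depth}(\mathrm{CCDT}_\ell(\mathscr F\upharpoonright\rho(\varrho,y)))\ge t\bigr]\le 16^{t+\ell}M^{\lceil t/\ell\rceil}(32pk)^t+\delta.$$ -/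

import Mathlib

namespace MultiSwitching

/-! ### Formulas and restrictions -/

/-- A restriction of `x_1, …, x_n`: `none` is the symbol `*`, `some b` fixes the variable to `b`. -/
abbrev Restriction (n : ℕ) := Fin n → Option Bool

/-- A literal. `pos i` is `x_i`, `neg i` is its negation; constants are included so that formulas
are closed under substituting constants for variables. -/
inductive Lit (n : ℕ) where
  | const (b : Bool) : Lit n
  | pos (i : Fin n) : Lit n
  | neg (i : Fin n) : Lit n
  deriving DecidableEq

/-- The value of a literal at an assignment. -/
def Lit.eval {n : ℕ} (x : Fin n → Bool) : Lit n → Bool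
  | .const b => b
  | .pos i => x i
  | .neg i => !(x i)

/-- The set of variables (zero or one) of a literal. -/
def Lit.vars {n : ℕ} : Lit n → Finset (Fin n)
  | .const _ => ∅
  | .pos i => {i}
  | .neg i => {i}

/-- Substitute the values fixed by `ρ` into a literal. -/
def Lit.restrict {n : ℕ} (ρ : Restriction n) : Lit n → Lit n
  | .const b => .const b
  | .pos i => match ρ i with
    | some b => .const b
    | none => .pos i
  | .neg i => match ρ i with
    | some b => .const (!b)
    | none => .neg i

/-- A clause: a disjunction of literals. Its width is the length of the list. -/
abbrev Clause (n : ℕ) := List (Lit n)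

/-- The value of a clause at an assignment. -/
def Clause.eval {n : ℕ} (x : Fin n → Bool) (C : Clause n) : Bool := C.any (Lit.eval x)

/-- The clause is identically `1`. -/
def Clause.isOne {n : ℕ} (C : Clause n) : Bool :=
  decide (∀ x : Fin n → Bool, Clause.eval x C = true)

/-- The clause is identically `0`. -/
def Clause.isZero {n : ℕ} (C : Clause n) : Bool :=
  decide (∀ x : Fin n → Bool, Clause.eval x C = false)

/-- The variables that occur in a clause. -/
def Clause.vars {n : ℕ} (C : Clause n) : Finset (Fin n) :=
  Finset.univ.filter fun i => ∃ l ∈ C, i ∈ l.vars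

/-- The variables that occur in a clause, each once, in increasing order. -/
def Clause.varList {n : ℕ} (C : Clause n) : List (Fin n) := (Clause.vars C).sort (· ≤ ·)

/-- The clause `C ↾ ρ`. -/
def Clause.restrict {n : ℕ} (ρ : Restriction n) (C : Clause n) : Clause n :=
  C.map (Lit.restrict ρ)

/-- A CNF: an ordered sequence of clauses. -/
abbrev CNF (n : ℕ) := List (Clause n)

/-- `F` is a `k`-CNF with (at most) `Q` clauses. -/
def CNF.IsKCNF {n : ℕ} (Q k : ℕ) (F : CNF n) : Prop :=
  F.length ≤ Q ∧ ∀ C ∈ F, C.length ≤ k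

/-- The formula `F ↾ ρ`. -/
def CNF.restrict {n : ℕ} (ρ : Restriction n) (F : CNF n) : CNF n :=
  F.map (Clause.restrict ρ)

/-- Some clause of `F` is identically `0`. -/
def CNF.hasZero {n : ℕ} (F : CNF n) : Bool := F.any Clause.isZero

/-- The first clause of `F` that is not identically `1`, if there is one. -/
def CNF.firstLive {n : ℕ} (F : CNF n) : Option (Clause n) := F.find? fun C => !(Clause.isOne C)

/-- The restriction that fixes exactly the variables in `S`, to the values given by `v`. -/
def fixOn {n : ℕ} (S : Finset (Fin n)) (v : Fin n → Bool) : Restriction n :=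
  fun i => if i ∈ S then some (v i) else none

/-! ### Decision trees -/

/-- Decision trees over `x_1, …, x_n` with leaves labelled by `α`;
in `query i T₀ T₁` the tree `T_b` is followed if `x_i = b`. -/
inductive DTree (n : ℕ) (α : Type) where
  | leaf (a : α) : DTree n α
  | query (i : Fin n) (lo hi : DTree n α) : DTree n α

/-- The depth of a decision tree. -/
def DTree.depth {n : ℕ} {α : Type} : DTree n α → ℕ
  | .leaf _ => 0
  | .query _ lo hi => max lo.depth hi.depth + 1

/-- The tree that exhaustively queries the variables of the (duplicate-free) list, one per level,
and continues with `sub v` at the leaf where the listed variables have been given the values `v`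
(variables outside of the list are set to `false` in `v`). -/
def queryAll {n : ℕ} {α : Type} :
    List (Fin n) → ((Fin n → Bool) → DTree n α) → DTree n α
  | [], sub => sub fun _ => false
  | i :: L, sub =>
      .query i (queryAll L fun v => sub (Function.update v i false))
        (queryAll L fun v => sub (Function.update v i true))

/-! ### The canonical decision tree -/

/-- The number of variables that occur in `F`. -/
def CNF.numVars {n : ℕ} (F : CNF n) : ℕ :=
  (Finset.univ.filter fun i : Fin n => ∃ C ∈ F, i ∈ Clause.vars C).card

theorem Lit.mem_vars_restrict {n : ℕ} {ρ : Restriction n} {l : Lit n} {i : Fin n}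
    (h : i ∈ (l.restrict ρ).vars) : i ∈ l.vars ∧ ρ i = none := by
  cases l with
  | const b => simp [Lit.restrict, Lit.vars] at h
  | pos j =>
    cases hj : ρ j with
    | none =>
      simp only [Lit.restrict, hj, Lit.vars, Finset.mem_singleton] at h
      subst h
      simp [Lit.vars, hj]
    | some b => simp [Lit.restrict, hj, Lit.vars] at h
  | neg j =>
    cases hj : ρ j with
    | none =>
      simp only [Lit.restrict, hj, Lit.vars, Finset.mem_singleton] at h
      subst h
      simp [Lit.vars, hj]
    | some b => simp [Lit.restrict, hj, Lit.vars] at h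

theorem Clause.mem_vars {n : ℕ} {C : Clause n} {i : Fin n} :
    i ∈ Clause.vars C ↔ ∃ l ∈ C, i ∈ l.vars :=
  Finset.mem_filter.trans (and_iff_right (Finset.mem_univ i))

theorem Clause.mem_vars_restrict {n : ℕ} {ρ : Restriction n} {C : Clause n} {i : Fin n}
    (h : i ∈ Clause.vars (Clause.restrict ρ C)) : i ∈ Clause.vars C ∧ ρ i = none := by
  obtain ⟨l', hl', hi⟩ := Clause.mem_vars.1 h
  obtain ⟨l, hl, rfl⟩ := List.mem_map.1 hl'
  have h2 := Lit.mem_vars_restrict hi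
  exact ⟨Clause.mem_vars.2 ⟨l, hl, h2.1⟩, h2.2⟩

/-- A clause without variables is constant. -/
theorem Clause.eval_eq_of_vars_eq_empty {n : ℕ} {C : Clause n} (h : Clause.vars C = ∅)
    (x y : Fin n → Bool) : Clause.eval x C = Clause.eval y C := by
  have key : ∀ l ∈ C, Lit.eval x l = Lit.eval y l := by
    intro l hl
    cases l with
    | const b => rfl
    | pos i =>
      have : i ∈ Clause.vars C := Clause.mem_vars.2 ⟨_, hl, by simp [Lit.vars]⟩
      simp [h] at this
    | neg i =>
      have : i ∈ Clause.vars C := Clause.mem_vars.2 ⟨_, hl, by simp [Lit.vars]⟩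
      simp [h] at this
  rw [Bool.eq_iff_iff]
  simp only [Clause.eval, List.any_eq_true]
  constructor
  · rintro ⟨l, hl, hx⟩
    exact ⟨l, hl, by rw [← key l hl]; exact hx⟩
  · rintro ⟨l, hl, hx⟩
    exact ⟨l, hl, by rw [key l hl]; exact hx⟩

/-- Fixing the variables of the first clause that is not constantly `1` leaves fewer variables. -/
theorem CNF.numVars_restrict_lt {n : ℕ} {F : CNF n} {C : Clause n} (h0 : ¬ F.hasZero = true)
    (hC : F.firstLive = some C) (v : Fin n → Bool) :
    CNF.numVars (F.restrict (fixOn (Clause.vars C) v)) < F.numVars := by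
  have hmem : C ∈ F := List.mem_of_find?_eq_some hC
  have hone : ¬ Clause.isOne C = true := by
    have := List.find?_some hC
    simpa using this
  have hzero : ¬ Clause.isZero C = true := by
    intro h
    exact h0 (List.any_eq_true.2 ⟨C, hmem, h⟩)
  have hne : (Clause.vars C).Nonempty := by
    rw [Finset.nonempty_iff_ne_empty]
    intro he
    rcases hb : Clause.eval (fun _ => false) C with _ | _
    · refine hzero (decide_eq_true fun x => ?_)
      rw [Clause.eval_eq_of_vars_eq_empty he x fun _ => false, hb]
    · refine hone (decide_eq_true fun x => ?_)
      rw [Clause.eval_eq_of_vars_eq_empty he x fun _ => false, hb]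
  obtain ⟨i, hi⟩ := hne
  have key : ∀ j, (∃ D ∈ F.restrict (fixOn (Clause.vars C) v), j ∈ Clause.vars D) →
      (∃ D ∈ F, j ∈ Clause.vars D) ∧ j ∉ Clause.vars C := by
    rintro j ⟨D', hD', hj⟩
    obtain ⟨D, hD, rfl⟩ := List.mem_map.1 hD'
    have h2 := Clause.mem_vars_restrict hj
    refine ⟨⟨D, hD, h2.1⟩, fun hjC => ?_⟩
    simp [fixOn, hjC] at h2
  refine Finset.card_lt_card ⟨fun j hj => ?_, fun hsub => ?_⟩
  · exact Finset.mem_filter.2 ⟨Finset.mem_univ j, (key j (Finset.mem_filter.1 hj).2).1⟩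
  · exact (key i (Finset.mem_filter.1
      (hsub (Finset.mem_filter.2 ⟨Finset.mem_univ i, C, hmem, hi⟩))).2).2 hi

/-- The canonical decision tree `CDT(F)`. -/
def cdt {n : ℕ} (F : CNF n) : DTree n Bool :=
  if h0 : F.hasZero = true then .leaf false
  else
    match hC : F.firstLive with
    | none => .leaf true
    | some C =>
        queryAll (Clause.varList C) fun v => cdt (F.restrict (fixOn (Clause.vars C) v))
termination_by F.numVars
decreasing_by exact CNF.numVars_restrict_lt h0 hC v

/-- `IsFullPath F η`: the list `η` of queries and answers is a path from the root of `CDT(F)` that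
is full, i.e. it splits into consecutive segments, each an assignment to *all* the surviving
variables of the first clause that is not identically `1` under the previous segments. -/
inductive IsFullPath {n : ℕ} : CNF n → List (Fin n × Bool) → Prop
  | nil (F : CNF n) : IsFullPath F []
  | segment (F : CNF n) (C : Clause n) (v : Fin n → Bool) (η : List (Fin n × Bool))
      (h0 : ¬ F.hasZero = true) (hC : F.firstLive = some C)
      (hη : IsFullPath (F.restrict (fixOn (Clause.vars C) v)) η) :
      IsFullPath F ((Clause.varList C).map (fun i => (i, v i)) ++ η)

/-! ### Canonical common partial decision trees -/

/-- `IsCCDT k ℓ 𝓕 T`: the tree `T` is a canonical common `ℓ`-partial decision tree for the ordered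
collection `𝓕` of `k`-CNFs. Leaves carry no label. -/
inductive IsCCDT {n : ℕ} (k ℓ : ℕ) : List (CNF n) → DTree n Unit → Prop
  | nil : IsCCDT k ℓ [] (.leaf ())
  | skip (F : CNF n) (𝓕 : List (CNF n)) (T : DTree n Unit)
      (hF : (cdt F).depth ≤ ℓ) (hT : IsCCDT k ℓ 𝓕 T) : IsCCDT k ℓ (F :: 𝓕) T
  | branch (F : CNF n) (𝓕 : List (CNF n)) (η : List (Fin n × Bool))
      (sub : (Fin n → Bool) → DTree n Unit)
      (hF : ℓ < (cdt F).depth) (hη : IsFullPath F η)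
      (hlo : ℓ + 1 ≤ η.length) (hhi : η.length ≤ ℓ + k)
      (hsub : ∀ v : Fin n → Bool,
        IsCCDT k ℓ ((F :: 𝓕).map (CNF.restrict (fixOn (η.map Prod.fst).toFinset v))) (sub v)) :
      IsCCDT k ℓ (F :: 𝓕) (queryAll (η.map Prod.fst) sub)

/-- The set `CCDT_ℓ(𝓕)` of canonical common `ℓ`-partial decision trees. -/
def CCDT {n : ℕ} (k ℓ : ℕ) (𝓕 : List (CNF n)) : Set (DTree n Unit) := {T | IsCCDT k ℓ 𝓕 T}

/-- `depth(CCDT_ℓ(𝓕))`: the maximum depth of a tree in `CCDT_ℓ(𝓕)`. -/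
noncomputable def ccdtDepth {n : ℕ} (k ℓ : ℕ) (𝓕 : List (CNF n)) : ℕ∞ :=
  ⨆ T ∈ CCDT k ℓ 𝓕, (T.depth : ℕ∞)

/-! ### Bit-encodings of restrictions -/

/-- The index set `Y_q` of the bits of `(ϱ, y) ∈ {0,1}^{n × q} × {0,1}^n`. -/
abbrev EncIndex (n q : ℕ) := (Fin n × Fin q) ⊕ Fin n

/-- The restriction `ρ(ϱ, y)`: star at `i` if all of `ϱ_{i,1}, …, ϱ_{i,q}` are `1`, and `y_i`
otherwise. -/
def decodeRestriction {n q : ℕ} (z : EncIndex n q → Bool) : Restriction n :=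
  fun i => if ∀ j : Fin q, z (.inl (i, j)) = true then none else some (z (.inr i))

/-! ### Small-depth circuits -/

/-- A Boolean circuit over the input variables `ι`: a directed acyclic graph of AND and OR gates of
unbounded fan-in, numbered in topological order. The inputs of a gate are literals (`(i, true)` is
the variable `i`, `(i, false)` its negation) and earlier gates; the output is a literal or a
gate. -/
structure Circuit (ι : Type) where
  numGates : ℕ
  isAnd : Fin numGates → Bool
  litIn : Fin numGates → Finset (ι × Bool)
  gateIn : Fin numGates → Finset (Fin numGates)
  acyclic : ∀ g, ∀ h ∈ gateIn g, h < g
  output : (ι × Bool) ⊕ Fin numGates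

/-- The value of a literal at an input. -/
def litVal {ι : Type} (x : ι → Bool) (l : ι × Bool) : Bool := if l.2 then x l.1 else !(x l.1)

/-- The value of a gate at an input. -/
def Circuit.gateVal {ι : Type} (c : Circuit ι) (x : ι → Bool) (g : Fin c.numGates) : Bool :=
  if c.isAnd g = true then
    decide ((∀ l ∈ c.litIn g, litVal x l = true) ∧
      ∀ h : {h // h ∈ c.gateIn g}, c.gateVal x h.1 = true)
  else
    decide ((∃ l ∈ c.litIn g, litVal x l = true) ∨
      ∃ h : {h // h ∈ c.gateIn g}, c.gateVal x h.1 = true)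
termination_by g.val
decreasing_by all_goals exact c.acyclic _ _ (Subtype.property _)

/-- The value of a circuit at an input. -/
def Circuit.eval {ι : Type} (c : Circuit ι) (x : ι → Bool) : Bool :=
  match c.output with
  | .inl l => litVal x l
  | .inr g => c.gateVal x g

/-- The depth of a gate: the largest number of gates on a path from an input to it. -/
def Circuit.gateDepth {ι : Type} (c : Circuit ι) (g : Fin c.numGates) : ℕ :=
  ((c.gateIn g).attach.sup fun h => c.gateDepth h.1) + 1
termination_by g.val
decreasing_by exact c.acyclic g h.1 h.2

/-- The depth of a circuit. -/
def Circuit.depth {ι : Type} (c : Circuit ι) : ℕ :=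
  match c.output with
  | .inl _ => 0
  | .inr g => c.gateDepth g

/-- The size of a circuit: the number of its gates together with the input variables. -/
def Circuit.size {ι : Type} [Fintype ι] (c : Circuit ι) : ℕ := Fintype.card ι + c.numGates

/-- The functions computed by circuits of depth (at most) `d` and size (at most) `S`. -/
def circuitClass (ι : Type) [Fintype ι] (d S : ℕ) : Set ((ι → Bool) → Bool) :=
  {f | ∃ c : Circuit ι, c.depth ≤ d ∧ c.size ≤ S ∧ ∀ x, c.eval x = f x}

/-! ### Fooling -/

/-- The expectation of a real-valued function under a distribution on a finite set. -/
noncomputable def expect {Ω : Type} [Fintype Ω] (D : PMF Ω) (g : Ω → ℝ) : ℝ :=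
  ∑ x, (D x).toReal * g x

/-- The probability of an event under a distribution on a finite set. -/
noncomputable def prob {Ω : Type} [Fintype Ω] (D : PMF Ω) (A : Set Ω) : ℝ :=
  expect D (A.indicator fun _ => 1)

/-- The distribution `D` on `{0,1}^ι` `ε`-fools the class `𝒞` of Boolean functions. -/
def Fools {ι : Type} [Fintype ι] [DecidableEq ι] (D : PMF (ι → Bool)) (ε : ℝ)
    (𝒞 : Set ((ι → Bool) → Bool)) : Prop :=
  ∀ f ∈ 𝒞, |expect D (fun x => if f x = true then 1 else 0) -
    expect (PMF.uniformOfFintype (ι → Bool)) (fun x => if f x = true then 1 else 0)| ≤ ε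

end MultiSwitching

/-!
A union bound over descriptions of long branches, in which every single description is tested by a
small depth-3 circuit, and all of them together are counted under the uniform distribution by
falsifying the queried clauses.

*Descriptions.* If a tree in `CCDT_ℓ(𝓕 ↾ ρ)` has depth at least `t`, follow a branch up to the
clause with which the number of queries reaches `t`. It passes through at most `R = ⌈t / ℓ⌉` members
of `𝓕`, since each but the last accounts for more than `ℓ` queries. A description consists of the
sequence `𝓖` of these members (`M ^ R` choices) and of the list `w` of the earlier *segments*, one for each
queried clause, with the names of the variables, their values on the chosen full path and on the
branch, and the places where full paths end. As `w` queries fewer than `t` variables, there are at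
most `n ^ (5 * t)` choices for it (`card_biUnion_segLists_le`). The last clause is left out of the
description, because up to `k` variables would have to be named, and `k` may exceed `t`; it is only
required that it has enough live variables (`Reaches`). That skipped formulas have shallow trees is
not part of the test either: dropping this only enlarges the events (`exists_reaches_of_isCCDT`).

*Tests.* Whether a description occurs is a conjunction of conditions on the first clause that is not
constantly `1` under `ρ` and the given values. Each says that some clause is not constantly `1`, and
that every clause is constantly `1`, or has the right variables, or comes after one that is not
constantly `1`. The state of a clause depends on `k (q + 1)` bits, so this is an AND of ORs of ANDs
(`isAndOrAnd_firstLive`); repeated clauses can be deleted, so its size is at most `n ^ O(ℓ)` times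
`2 ^ O(k q)` (`test_size_le`).

*Uniform distribution.* Complete `w` by the last segment, with `T ≥ t` variables in total. All these
variables are free under `ρ`, which costs a factor `p ^ T`, and the bits of `y` there are irrelevant.
Choose them so that each queried clause is false until it is queried (`exists_along_falsified`); this
costs a factor `2 ^ T`. As the clauses before the first live one are constantly `1`, a queried clause
is now the *first false* clause of its formula at a completely known assignment. So each variable is
named by one of `k` positions, and at most `(12 * k) ^ T` lists of segments are possible for each
assignment (`card_filter_falsified_le`). The expected number of descriptions with `T` variables thus
is at most `(24 * p * k) ^ T` (`sum_card_live_mul_le`), and `T` takes at most `k` values. If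
`32 * p * k > 1`, the claimed bound exceeds `1`.
-/

namespace MultiSwitching

/-! ### Circuits of the form AND of ORs of ANDs -/

/-- `f` is an OR of at most `b` conjunctions of literals. -/
def IsOrAnd {ι : Type} (b : ℕ) (f : (ι → Bool) → Prop) : Prop :=
  ∃ u : List (List (ι × Bool)), u.length ≤ b ∧
    ∀ x, f x ↔ ∃ v ∈ u, ∀ l ∈ v, litVal x l = true

/-- `f` is an AND of at most `a` functions, each an OR of at most `b` conjunctions of literals. -/
def IsAndOrAnd {ι : Type} (a b : ℕ) (f : (ι → Bool) → Prop) : Prop :=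
  ∃ Φ : List (List (List (ι × Bool))), Φ.length ≤ a ∧ (∀ u ∈ Φ, u.length ≤ b) ∧
    ∀ x, f x ↔ ∀ u ∈ Φ, ∃ v ∈ u, ∀ l ∈ v, litVal x l = true

section
variable {ι : Type}

theorem IsOrAnd.congr {b : ℕ} {f g : (ι → Bool) → Prop} (hf : IsOrAnd b f)
    (h : ∀ x, g x ↔ f x) : IsOrAnd b g := by
  obtain ⟨u, hu, hx⟩ := hf
  exact ⟨u, hu, fun x => (h x).trans (hx x)⟩

theorem IsOrAnd.or {b c : ℕ} {f g : (ι → Bool) → Prop} (hf : IsOrAnd b f) (hg : IsOrAnd c g) :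
    IsOrAnd (b + c) fun x => f x ∨ g x := by
  obtain ⟨u, hu, hx⟩ := hf
  obtain ⟨v, hv, hy⟩ := hg
  refine ⟨u ++ v, by simpa using Nat.add_le_add hu hv, fun x => ?_⟩
  simp only [hx, hy, List.mem_append, or_and_right, exists_or]

theorem IsOrAnd.exists_mem {α : Type} {b : ℕ} (f : α → (ι → Bool) → Prop) :
    ∀ L : List α, (∀ D ∈ L, IsOrAnd b (f D)) →
      IsOrAnd (L.length * b) fun x => ∃ D ∈ L, f D x := by
  intro L
  induction L with
  | nil => exact fun _ => ⟨[], by simp, by simp⟩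
  | cons D L ih =>
    intro h
    have h1 := (h D (by simp)).or (ih fun E hE => h E (by simp [hE]))
    refine IsOrAnd.congr (b := (D :: L).length * b) ?_ fun x => by
      rw [List.exists_mem_cons_iff]
    rw [List.length_cons, Nat.add_mul, Nat.one_mul, Nat.add_comm]
    exact h1

/-- A function of at most `m` input bits is an OR of at most `2 ^ m` conjunctions. -/
theorem isOrAnd_of_dependsOn [DecidableEq ι] {m : ℕ} (K : Finset ι) (hK : K.card ≤ m)
    (f : (ι → Bool) → Prop) (hf : ∀ x y, (∀ i ∈ K, x i = y i) → (f x ↔ f y)) :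
    IsOrAnd (2 ^ m) f := by
  classical
  refine ⟨(K.powerset.toList.filter fun T => decide (f fun i => decide (i ∈ T))).map
    fun T => K.toList.map fun i => (i, decide (i ∈ T)), ?_, fun x => ?_⟩
  · rw [List.length_map]
    refine (List.length_filter_le _ _).trans ?_
    rw [Finset.length_toList, Finset.card_powerset]
    exact Nat.pow_le_pow_right (by norm_num) hK
  · have key : ∀ T : Finset ι, (∀ l ∈ K.toList.map fun i => (i, decide (i ∈ T)),
        litVal x l = true) ↔ ∀ i ∈ K, x i = decide (i ∈ T) := by
      intro T
      simp only [List.forall_mem_map, Finset.mem_toList, litVal]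
      refine forall₂_congr fun i _ => ?_
      by_cases h : i ∈ T <;> simp [h]
    simp only [List.mem_map (f := fun T : Finset ι => K.toList.map fun i => (i, decide (i ∈ T))),
      exists_exists_and_eq_and, List.mem_filter, Finset.mem_toList,
      Finset.mem_powerset, decide_eq_true_eq, key]
    constructor
    · intro hx
      have h1 : ∀ i ∈ K, x i = decide (i ∈ K.filter fun i => x i = true) := by
        intro i hi
        rcases hb : x i <;> simp [hi, hb]
      exact ⟨K.filter fun i => x i = true, ⟨Finset.filter_subset _ _, (hf _ _ h1).1 hx⟩, h1⟩
    · rintro ⟨T, ⟨-, hT⟩, h1⟩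
      exact (hf _ _ h1).2 hT

theorem IsAndOrAnd.congr {a b : ℕ} {f g : (ι → Bool) → Prop} (hf : IsAndOrAnd a b f)
    (h : ∀ x, g x ↔ f x) : IsAndOrAnd a b g := by
  obtain ⟨Φ, h1, h2, h3⟩ := hf
  exact ⟨Φ, h1, h2, fun x => (h x).trans (h3 x)⟩

theorem IsOrAnd.isAndOrAnd {b : ℕ} {f : (ι → Bool) → Prop} (hf : IsOrAnd b f) :
    IsAndOrAnd 1 b f := by
  obtain ⟨u, hu, hx⟩ := hf
  exact ⟨[u], by simp, by simpa using hu, by simpa using hx⟩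

theorem isAndOrAnd_true (b : ℕ) : IsAndOrAnd (ι := ι) 0 b fun _ => True :=
  ⟨[], by simp, by simp, by simp⟩

theorem IsAndOrAnd.and {a a' b : ℕ} {f g : (ι → Bool) → Prop} (hf : IsAndOrAnd a b f)
    (hg : IsAndOrAnd a' b g) : IsAndOrAnd (a + a') b fun x => f x ∧ g x := by
  obtain ⟨Φ, h1, h2, h3⟩ := hf
  obtain ⟨Ψ, h1', h2', h3'⟩ := hg
  refine ⟨Φ ++ Ψ, by simpa using Nat.add_le_add h1 h1', fun u hu => ?_, fun x => ?_⟩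
  · rcases List.mem_append.1 hu with hu | hu
    exacts [h2 u hu, h2' u hu]
  · simp only [h3, h3', List.mem_append, or_imp, forall_and]

theorem IsAndOrAnd.forall_mem {α : Type} {b : ℕ} (f : α → (ι → Bool) → Prop) :
    ∀ L : List α, (∀ D ∈ L, IsOrAnd b (f D)) →
      IsAndOrAnd L.length b fun x => ∀ D ∈ L, f D x := by
  intro L
  induction L with
  | nil => exact fun _ => (isAndOrAnd_true b).congr (by simp)
  | cons D L ih =>
    intro h
    have h1 := (h D (by simp)).isAndOrAnd.and (ih fun E hE => h E (by simp [hE]))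
    rw [List.length_cons, Nat.add_comm]
    exact h1.congr fun x => by rw [List.forall_mem_cons]

theorem Circuit.gateDepth_le {c : Circuit ι} {g : Fin c.numGates} {d : ℕ}
    (h : ∀ h ∈ c.gateIn g, c.gateDepth h ≤ d) : c.gateDepth g ≤ d + 1 := by
  rw [Circuit.gateDepth]
  exact Nat.succ_le_succ (Finset.sup_le fun x _ => h x.1 x.2)

variable [DecidableEq ι]

/-- The circuit for `⋀ u ∈ Φ, ⋁ v ∈ u, ⋀ l ∈ v, l`, where every `u ∈ Φ` has length at most `b`.
The gate for the `j`-th conjunction of the `i`-th member of `Φ` has number `i * b + j`; these are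
followed by one OR gate for each member of `Φ`, and by the output gate. -/
def threeLayerCircuit (Φ : List (List (List (ι × Bool)))) (b : ℕ) : Circuit ι where
  numGates := Φ.length * b + Φ.length + 1
  isAnd g := decide (g.1 < Φ.length * b ∨ Φ.length * b + Φ.length ≤ g.1)
  litIn g := if g.1 < Φ.length * b then ((Φ.getD (g.1 / b) []).getD (g.1 % b) []).toFinset else ∅
  gateIn g :=
    if g.1 < Φ.length * b then ∅
    else if g.1 < Φ.length * b + Φ.length then
      Finset.univ.filter fun h => h.1 < Φ.length * b ∧ h.1 / b = g.1 - Φ.length * b ∧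
        h.1 % b < (Φ.getD (h.1 / b) []).length
    else Finset.univ.filter fun h => Φ.length * b ≤ h.1 ∧ h.1 < Φ.length * b + Φ.length
  acyclic g h hh := by
    rw [Fin.lt_def]
    split_ifs at hh
    · simp at hh
    · have := (Finset.mem_filter.1 hh).2
      omega
    · have := (Finset.mem_filter.1 hh).2
      omega
  output := .inr ⟨Φ.length * b + Φ.length, by omega⟩

theorem isAnd_threeLayerCircuit (Φ : List (List (List (ι × Bool)))) (b : ℕ)
    (g : Fin (threeLayerCircuit Φ b).numGates) : (threeLayerCircuit Φ b).isAnd g = true ↔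
      g.1 < Φ.length * b ∨ Φ.length * b + Φ.length ≤ g.1 :=
  decide_eq_true_iff

theorem litIn_threeLayerCircuit (Φ : List (List (List (ι × Bool)))) (b : ℕ)
    (g : Fin (threeLayerCircuit Φ b).numGates) : (threeLayerCircuit Φ b).litIn g =
      if g.1 < Φ.length * b then ((Φ.getD (g.1 / b) []).getD (g.1 % b) []).toFinset else ∅ :=
  rfl

theorem mem_gateIn_threeLayerCircuit (Φ : List (List (List (ι × Bool)))) (b : ℕ)
    (g h : Fin (threeLayerCircuit Φ b).numGates) : h ∈ (threeLayerCircuit Φ b).gateIn g ↔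
      ¬ g.1 < Φ.length * b ∧
        (g.1 < Φ.length * b + Φ.length → h.1 < Φ.length * b ∧ h.1 / b = g.1 - Φ.length * b ∧
          h.1 % b < (Φ.getD (h.1 / b) []).length) ∧
        (¬ g.1 < Φ.length * b + Φ.length →
          Φ.length * b ≤ h.1 ∧ h.1 < Φ.length * b + Φ.length) := by
  unfold threeLayerCircuit at g h ⊢
  dsimp only at g h ⊢
  split_ifs with h1 h2
  · simp [h1]
  · simp [h1, h2]
  · simp [h1, h2]

theorem depth_threeLayerCircuit (Φ : List (List (List (ι × Bool)))) (b : ℕ) :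
    (threeLayerCircuit Φ b).depth ≤ 3 := by
  have h1 : ∀ g : Fin (threeLayerCircuit Φ b).numGates, g.1 < Φ.length * b →
      (threeLayerCircuit Φ b).gateDepth g ≤ 1 := by
    intro g hg
    refine Circuit.gateDepth_le (d := 0) fun h hh => ?_
    exact absurd hg ((mem_gateIn_threeLayerCircuit Φ b g h).1 hh).1
  have h2 : ∀ g : Fin (threeLayerCircuit Φ b).numGates, ¬ g.1 < Φ.length * b →
      g.1 < Φ.length * b + Φ.length → (threeLayerCircuit Φ b).gateDepth g ≤ 2 := by
    intro g hg hg'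
    refine Circuit.gateDepth_le (d := 1) fun h hh => h1 h ?_
    exact (((mem_gateIn_threeLayerCircuit Φ b g h).1 hh).2.1 hg').1
  refine Circuit.gateDepth_le (d := 2) fun h hh => ?_
  have := ((mem_gateIn_threeLayerCircuit Φ b _ h).1 hh).2.2 (lt_irrefl _)
  exact h2 h (by omega) this.2

theorem eval_threeLayerCircuit (Φ : List (List (List (ι × Bool)))) (b : ℕ)
    (hb : ∀ u ∈ Φ, u.length ≤ b) (x : ι → Bool) :
    (threeLayerCircuit Φ b).eval x = true ↔ ∀ u ∈ Φ, ∃ v ∈ u, ∀ l ∈ v, litVal x l = true := by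
  have h1 : ∀ g : Fin (threeLayerCircuit Φ b).numGates, g.1 < Φ.length * b →
      ((threeLayerCircuit Φ b).gateVal x g = true ↔
        ∀ l ∈ (Φ.getD (g.1 / b) []).getD (g.1 % b) [], litVal x l = true) := by
    intro g hg
    have hin : ∀ h, h ∉ (threeLayerCircuit Φ b).gateIn g := fun h hh =>
      ((mem_gateIn_threeLayerCircuit Φ b g h).1 hh).1 hg
    rw [Circuit.gateVal, if_pos ((isAnd_threeLayerCircuit Φ b g).2 (Or.inl hg)), decide_eq_true_eq,
      litIn_threeLayerCircuit, if_pos hg]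
    simp only [List.mem_toFinset]
    exact and_iff_left fun h => absurd h.2 (hin h.1)
  have h2 : ∀ g : Fin (threeLayerCircuit Φ b).numGates, ¬ g.1 < Φ.length * b →
      g.1 < Φ.length * b + Φ.length → ((threeLayerCircuit Φ b).gateVal x g = true ↔
        ∃ v ∈ Φ.getD (g.1 - Φ.length * b) [], ∀ l ∈ v, litVal x l = true) := by
    intro g hg hg'
    have hin : ∀ h, h ∈ (threeLayerCircuit Φ b).gateIn g ↔ h.1 < Φ.length * b ∧
        h.1 / b = g.1 - Φ.length * b ∧ h.1 % b < (Φ.getD (h.1 / b) []).length := by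
      intro h
      rw [mem_gateIn_threeLayerCircuit]
      simp only [hg, hg', not_false_eq_true, true_and, forall_true_left, not_true, false_imp_iff,
        and_true]
    have hlit : (threeLayerCircuit Φ b).litIn g = ∅ := by
      rw [litIn_threeLayerCircuit, if_neg hg]
    have hand : ¬ (threeLayerCircuit Φ b).isAnd g = true := by
      rw [isAnd_threeLayerCircuit]
      omega
    rw [Circuit.gateVal, if_neg hand]
    simp only [hlit, decide_eq_true_eq]
    constructor
    · rintro (⟨l, hl, -⟩ | ⟨⟨h, hh⟩, hv⟩)
      · simp at hl
      · have h3 := (hin h).1 hh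
        refine ⟨(Φ.getD (h.1 / b) []).getD (h.1 % b) [], ?_, (h1 h h3.1).1 hv⟩
        rw [← h3.2.1, List.getD_eq_getElem _ _ h3.2.2]
        exact List.getElem_mem _
    · rintro ⟨v, hv, hl⟩
      obtain ⟨j, hj, rfl⟩ := List.getElem_of_mem hv
      have hi : g.1 - Φ.length * b < Φ.length := by omega
      have hjb : j < b := lt_of_lt_of_le hj (by
        rw [List.getD_eq_getElem _ _ hi]
        exact hb _ (List.getElem_mem _))
      set i := g.1 - Φ.length * b with hidef
      have hlt : i * b + j < Φ.length * b := by nlinarith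
      have hdiv : (i * b + j) / b = i := by
        rw [Nat.mul_comm, Nat.mul_add_div (by omega), Nat.div_eq_of_lt hjb, Nat.add_zero]
      have hmod : (i * b + j) % b = j := by
        rw [Nat.mul_comm, Nat.mul_add_mod, Nat.mod_eq_of_lt hjb]
      have hN : i * b + j < (threeLayerCircuit Φ b).numGates := by
        simp only [threeLayerCircuit]
        omega
      refine Or.inr ⟨⟨⟨i * b + j, hN⟩, (hin _).2 ?_⟩, (h1 _ hlt).2 ?_⟩
      · dsimp only
        rw [hdiv, hmod]
        exact ⟨hlt, rfl, hj⟩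
      · simp only [hdiv, hmod]
        rw [List.getD_eq_getElem _ _ hj]
        exact hl
  have hN : Φ.length * b + Φ.length < (threeLayerCircuit Φ b).numGates := Nat.lt_succ_self _
  have hin : ∀ h, h ∈ (threeLayerCircuit Φ b).gateIn ⟨_, hN⟩ ↔
      Φ.length * b ≤ h.1 ∧ h.1 < Φ.length * b + Φ.length := by
    intro h
    rw [mem_gateIn_threeLayerCircuit]
    simp
  have hlit : (threeLayerCircuit Φ b).litIn ⟨_, hN⟩ = ∅ := by
    rw [litIn_threeLayerCircuit, if_neg (by simp)]
  have hval : (threeLayerCircuit Φ b).eval x = (threeLayerCircuit Φ b).gateVal x ⟨_, hN⟩ := rfl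
  rw [hval, Circuit.gateVal, if_pos ((isAnd_threeLayerCircuit Φ b _).2 (Or.inr le_rfl)),
    decide_eq_true_eq, hlit]
  constructor
  · rintro ⟨-, h⟩ u hu
    obtain ⟨i, hi, rfl⟩ := List.getElem_of_mem hu
    have hN' : Φ.length * b + i < (threeLayerCircuit Φ b).numGates := by omega
    have h3 := h ⟨⟨Φ.length * b + i, hN'⟩, (hin _).2 ⟨by simp, by simpa using hi⟩⟩
    rw [h2 _ (by simp) (by simpa using hi)] at h3
    simpa [hi] using h3
  · refine fun h => ⟨fun l hl => absurd hl (Finset.notMem_empty l), fun ⟨g, hg⟩ => ?_⟩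
    have hg' := (hin g).1 hg
    refine (h2 g (by omega) hg'.2).2 (h _ ?_)
    have hi : g.1 - Φ.length * b < Φ.length := by omega
    rw [List.getD_eq_getElem _ _ hi]
    exact List.getElem_mem _

theorem IsAndOrAnd.mem_circuitClass [Fintype ι] {a b S : ℕ} {f : (ι → Bool) → Bool}
    (hf : IsAndOrAnd a b fun x => f x = true) (hS : Fintype.card ι + (a * b + a + 1) ≤ S) :
    f ∈ circuitClass ι 3 S := by
  obtain ⟨Φ, h1, h2, h3⟩ := hf
  refine ⟨threeLayerCircuit Φ b, depth_threeLayerCircuit Φ b, le_trans ?_ hS, fun x => ?_⟩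
  · have : Φ.length * b ≤ a * b := Nat.mul_le_mul_right b h1
    simp only [Circuit.size, threeLayerCircuit]
    omega
  · rw [Bool.eq_iff_iff, eval_threeLayerCircuit Φ b h2 x]
    exact (h3 x).symm

end

/-! ### Composition of restrictions -/

section
variable {n : ℕ}

/-- The restriction `ρ`, with the variables left free by `ρ` restricted by `A`. -/
def extend (ρ A : Restriction n) : Restriction n := fun i => (ρ i).or (A i)

theorem extend_assoc (ρ A B : Restriction n) :
    extend (extend ρ A) B = extend ρ (extend A B) :=
  funext fun _ => Option.or_assoc

theorem extend_none (ρ : Restriction n) : extend ρ (fun _ => none) = ρ :=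
  funext fun _ => Option.or_none

theorem extend_eq_none {ρ A : Restriction n} {i : Fin n} :
    extend ρ A i = none ↔ ρ i = none ∧ A i = none :=
  Option.or_eq_none_iff

theorem Lit.restrict_restrict (ρ A : Restriction n) (l : Lit n) :
    (l.restrict ρ).restrict A = l.restrict (extend ρ A) := by
  cases l with
  | const b => rfl
  | pos i => rcases h : ρ i with _ | b <;> simp [Lit.restrict, extend, h]
  | neg i => rcases h : ρ i with _ | b <;> simp [Lit.restrict, extend, h]

theorem Clause.restrict_restrict (ρ A : Restriction n) (C : Clause n) :
    Clause.restrict A (Clause.restrict ρ C) = Clause.restrict (extend ρ A) C := by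
  simp [Clause.restrict, Lit.restrict_restrict]

theorem CNF.restrict_restrict (ρ A : Restriction n) (F : CNF n) :
    CNF.restrict A (CNF.restrict ρ F) = CNF.restrict (extend ρ A) F := by
  simp [CNF.restrict, Clause.restrict_restrict]

theorem CNF.restrict_none (F : CNF n) : CNF.restrict (fun _ => none) F = F := by
  have h : ∀ C : Clause n, Clause.restrict (fun _ => none) C = C := by
    intro C
    have : ∀ l : Lit n, l.restrict (fun _ => none) = l := by rintro (_ | _ | _) <;> rfl
    exact (List.map_congr_left fun l _ => this l).trans (List.map_id' C)
  exact (List.map_congr_left fun C _ => h C).trans (List.map_id' F)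

theorem Clause.mem_varList {C : Clause n} {i : Fin n} :
    i ∈ Clause.varList C ↔ i ∈ Clause.vars C := by
  simp [Clause.varList]

theorem Clause.length_varList (C : Clause n) :
    (Clause.varList C).length = (Clause.vars C).card := by
  simp [Clause.varList]

theorem Clause.varList_ne_nil {F : CNF n} {C : Clause n} (h0 : ¬ F.hasZero = true)
    (hC : F.firstLive = some C) : Clause.varList C ≠ [] := by
  intro h
  have hv : Clause.vars C = ∅ := by
    rw [← Finset.card_eq_zero, ← Clause.length_varList, h, List.length_nil]
  have h1 := CNF.numVars_restrict_lt h0 hC fun _ => false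
  have h2 : fixOn (∅ : Finset (Fin n)) (fun _ => false) = fun _ => none := by
    funext i
    simp [fixOn]
  rw [hv, h2, CNF.restrict_none] at h1
  exact lt_irrefl _ h1

theorem Clause.card_vars_le (C : Clause n) : (Clause.vars C).card ≤ C.length := by
  classical
  have h : Clause.vars C ⊆ C.toFinset.biUnion Lit.vars := by
    intro i hi
    obtain ⟨l, hl, hil⟩ := Clause.mem_vars.1 hi
    exact Finset.mem_biUnion.2 ⟨l, List.mem_toFinset.2 hl, hil⟩
  have h1 : ∀ l ∈ C.toFinset, (Lit.vars l).card ≤ 1 := by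
    rintro (_ | _ | _) - <;> simp [Lit.vars]
  refine (Finset.card_le_card h).trans ((Finset.card_biUnion_le_card_mul _ _ 1 h1).trans ?_)
  rw [Nat.mul_one]
  exact List.toFinset_card_le C

theorem lookup_map_eq_fixOn (L : List (Fin n)) (v : Fin n → Bool) (i : Fin n) :
    (L.map fun j => (j, v j)).lookup i = fixOn L.toFinset v i := by
  induction L with
  | nil => simp [fixOn]
  | cons j L ih =>
    rw [List.map_cons, List.lookup_cons, ih]
    by_cases h : i = j
    · subst h; simp [fixOn]
    · simp [fixOn, h, beq_eq_false_iff_ne.2 h]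

end

/-! ### Segments and the states they lead through -/

/-- A segment of a branch of a common partial decision tree: the variables of one queried clause,
each with its value on the chosen full path and its value on the branch, and a flag that tells
whether the segment is the last one of its full path. -/
abbrev Segment (n : ℕ) := List (Fin n × Bool × Bool) × Bool

/-- The variables of a segment. -/
def Segment.vars {n : ℕ} (s : Segment n) : List (Fin n) := s.1.map Prod.fst

/-- The values given to the variables of a segment by the chosen full path. -/
def Segment.pathVals {n : ℕ} (s : Segment n) : Restriction n :=
  fun i => (s.1.map fun e => (e.1, e.2.1)).lookup i

/-- The values given to the variables of a segment by the branch. -/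
def Segment.branchVals {n : ℕ} (s : Segment n) : Restriction n :=
  fun i => (s.1.map fun e => (e.1, e.2.2)).lookup i

/-- The number of variables queried in a list of segments. -/
def segSize {n : ℕ} (w : List (Segment n)) : ℕ := (w.map fun s => s.1.length).sum

/-- A position on a branch of a common partial decision tree: `formulas` lists the formula whose
canonical tree is being followed and the ones to be followed later, `path` holds the values of all
queried variables on the current full path (and on the branch, for the earlier full paths), and
`branch` holds the values of all queried variables on the branch. -/
structure State (n : ℕ) where
  formulas : List (CNF n)
  path : Restriction n
  branch : Restriction n

/-- The current formula; the empty (hence constantly `1`) CNF if there is none left. -/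
def State.formula {n : ℕ} (st : State n) : CNF n := st.formulas.headD []

/-- The position after a segment. At the end of a full path its values are replaced by those on the
branch, and the next formula becomes the current one. -/
def State.next {n : ℕ} (st : State n) (s : Segment n) : State n :=
  if s.2 then ⟨st.formulas.tail, extend st.branch s.branchVals, extend st.branch s.branchVals⟩
  else ⟨st.formulas, extend st.path s.pathVals, extend st.branch s.branchVals⟩

/-- Every segment of `w` satisfies `P` at the position where it starts. -/
def Along {n : ℕ} (P : State n → Segment n → Prop) : State n → List (Segment n) → Prop
  | _, [] => True
  | st, s :: w => P st s ∧ Along P (st.next s) w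

/-- The first live clause of the current formula under `ρ` and the path has exactly the variables
of the segment `s`. -/
def Live {n : ℕ} (ρ : Restriction n) (st : State n) (s : Segment n) : Prop :=
  ∃ C, (CNF.restrict (extend ρ st.path) st.formula).firstLive = some C ∧
    Clause.varList C = s.vars

/-- The segments `w`, all nonempty, are an initial part of a branch that queries fewer than `t`
variables, and one more segment brings the number of queried variables to at least `t`. -/
def Reaches {n : ℕ} (ρ : Restriction n) (t : ℕ) (st : State n) (w : List (Segment n)) : Prop :=
  ((∀ s ∈ w, s.1 ≠ []) ∧ Along (Live ρ) st w) ∧ segSize w < t ∧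
    ∃ C, (CNF.restrict (extend ρ (w.foldl State.next st).path)
        (w.foldl State.next st).formula).firstLive = some C ∧
      t ≤ segSize w + (Clause.varList C).length

section
variable {n : ℕ}

theorem along_append {P : State n → Segment n → Prop} :
    ∀ {st : State n} {w w' : List (Segment n)},
      Along P st (w ++ w') ↔ Along P st w ∧ Along P (w.foldl State.next st) w'
  | _, [], _ => (iff_of_eq (true_and _)).symm
  | st, s :: w, w' => by
    rw [List.cons_append, Along, Along, List.foldl_cons, and_assoc, along_append]

theorem segSize_cons (s : Segment n) (w : List (Segment n)) :
    segSize (s :: w) = s.1.length + segSize w := by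
  simp [segSize]

theorem segSize_append (w w' : List (Segment n)) :
    segSize (w ++ w') = segSize w + segSize w' := by
  simp [segSize]

theorem Reaches.cons {ρ : Restriction n} {t : ℕ} {st : State n} {s : Segment n}
    {w : List (Segment n)} (h0 : s.1 ≠ []) (hs : Live ρ st s) (hst : s.1.length ≤ t)
    (hw : Reaches ρ (t - s.1.length) (st.next s) w) : Reaches ρ t st (s :: w) := by
  obtain ⟨⟨h1, h2⟩, h3, C, hC, h4⟩ := hw
  refine ⟨⟨List.forall_mem_cons.2 ⟨h0, h1⟩, hs, h2⟩, ?_, C, hC, ?_⟩ <;> rw [segSize_cons] <;> omega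

/-! ### From branches of common partial decision trees to lists of segments -/

/-- The segment that queries all variables of `C`. -/
def clauseSegment (C : Clause n) (v u : Fin n → Bool) (e : Bool) : Segment n :=
  ((Clause.varList C).map fun i => (i, v i, u i), e)

theorem vars_clauseSegment (C : Clause n) (v u : Fin n → Bool) (e : Bool) :
    (clauseSegment C v u e).vars = Clause.varList C := by
  simp [clauseSegment, Segment.vars, Function.comp_def]

theorem length_clauseSegment (C : Clause n) (v u : Fin n → Bool) (e : Bool) :
    (clauseSegment C v u e).1.length = (Clause.varList C).length := by
  simp [clauseSegment]

theorem varList_toFinset (C : Clause n) : (Clause.varList C).toFinset = Clause.vars C := by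
  simp [Clause.varList]

theorem pathVals_clauseSegment (C : Clause n) (v u : Fin n → Bool) (e : Bool) :
    (clauseSegment C v u e).pathVals = fixOn (Clause.vars C) v := by
  funext i
  rw [← varList_toFinset, ← lookup_map_eq_fixOn]
  simp [clauseSegment, Segment.pathVals, Function.comp_def]

theorem branchVals_clauseSegment (C : Clause n) (v u : Fin n → Bool) (e : Bool) :
    (clauseSegment C v u e).branchVals = fixOn (Clause.vars C) u := by
  funext i
  rw [← varList_toFinset, ← lookup_map_eq_fixOn]
  simp [clauseSegment, Segment.branchVals, Function.comp_def]

theorem next_clauseSegment_true (st : State n) (C : Clause n) (v u : Fin n → Bool) :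
    st.next (clauseSegment C v u true) = ⟨st.formulas.tail, extend st.branch (fixOn C.vars u),
      extend st.branch (fixOn C.vars u)⟩ := by
  rw [← branchVals_clauseSegment C v u true]
  rfl

theorem next_clauseSegment_false (st : State n) (C : Clause n) (v u : Fin n → Bool) :
    st.next (clauseSegment C v u false) = ⟨st.formulas, extend st.path (fixOn C.vars v),
      extend st.branch (fixOn C.vars u)⟩ := by
  rw [← branchVals_clauseSegment C v u false, ← pathVals_clauseSegment C v u false]
  rfl

theorem extend_fixOn (S T : Finset (Fin n)) (u : Fin n → Bool) :
    extend (fixOn S u) (fixOn T u) = fixOn (S ∪ T) u := by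
  funext i
  by_cases h : i ∈ S <;> simp [extend, fixOn, h]

/-- A full path `η` of `F ↾ (ρ, A)` that is followed until `t` variables are queried. If it is shorter
than `t`, the branch, with the values `u` on the variables of `η`, goes on with the formulas `𝓖`. -/
theorem exists_reaches_of_isFullPath {H : CNF n} {η : List (Fin n × Bool)}
    (h : IsFullPath H η) (ρ : Restriction n) (F : CNF n) (𝓖 : List (CNF n)) (B : Restriction n)
    (u : Fin n → Bool) :
    ∀ (A B₀ : Restriction n) (t : ℕ), H = CNF.restrict (extend ρ A) F → η ≠ [] → 1 ≤ t →
      B = extend B₀ (fixOn (η.map Prod.fst).toFinset u) →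
      (η.length < t → ∃ w, Reaches ρ (t - η.length) ⟨𝓖, B, B⟩ w) →
      ∃ w, Reaches ρ t ⟨F :: 𝓖, A, B₀⟩ w := by
  induction h with
  | nil => exact fun _ _ _ _ h => absurd rfl h
  | segment H C v η h0 hC hη ih =>
    rintro A B₀ t rfl - ht hB hw
    have hlive : (CNF.restrict (extend ρ A) (State.formula ⟨F :: 𝓖, A, B₀⟩)).firstLive = some C :=
      hC
    rcases le_or_gt t (Clause.varList C).length with hle | hlt
    · exact ⟨[], ⟨by simp, trivial⟩, by simpa [segSize] using Nat.lt_of_lt_of_le Nat.one_pos ht,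
        C, hC, by simpa [segSize] using hle⟩
    · have hmap : (((Clause.varList C).map (fun i => (i, v i)) ++ η).map Prod.fst).toFinset =
          Clause.vars C ∪ (η.map Prod.fst).toFinset := by
        rw [List.map_append, List.toFinset_append, List.map_map, ← varList_toFinset]
        simp [Function.comp_def]
      rw [hmap, ← extend_fixOn, ← extend_assoc] at hB
      rw [List.length_append, List.length_map] at hw
      have hseg : ∀ e, (clauseSegment C v u e).1 ≠ [] := fun e he =>
        Clause.varList_ne_nil h0 hC (by rw [← vars_clauseSegment C v u e, Segment.vars, he]; rfl)
      have hlen := fun e => length_clauseSegment C v u e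
      by_cases hη0 : η = []
      · subst hη0
        obtain ⟨w, hw⟩ := hw (by simpa using hlt)
        refine ⟨clauseSegment C v u true :: w, .cons (hseg _)
          ⟨C, hlive, (vars_clauseSegment ..).symm⟩ (by rw [hlen]; exact hlt.le) ?_⟩
        have hB' : B = extend B₀ (fixOn (Clause.vars C) u) := by
          rw [hB]
          convert extend_none _
          simp [fixOn]
        rw [hlen]
        rw [next_clauseSegment_true, ← hB']
        simpa using hw
      · obtain ⟨w, hw⟩ := ih (extend A (fixOn (Clause.vars C) v))
          (extend B₀ (fixOn (Clause.vars C) u)) (t - (Clause.varList C).length)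
          (by rw [CNF.restrict_restrict, extend_assoc]) hη0 (by omega) hB fun hlt' => by
            obtain ⟨w, hw⟩ := hw (by omega)
            exact ⟨w, by rwa [Nat.sub_sub]⟩
        refine ⟨clauseSegment C v u false :: w, .cons (hseg _)
          ⟨C, hlive, (vars_clauseSegment ..).symm⟩ (by rw [hlen]; exact hlt.le) ?_⟩
        rw [hlen]
        rw [next_clauseSegment_false]
        exact hw

theorem exists_le_depth_queryAll {α : Type} {t : ℕ} :
    ∀ (L : List (Fin n)) (sub : (Fin n → Bool) → DTree n α), t ≤ (queryAll L sub).depth →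
      ∃ v, t ≤ L.length + (sub v).depth := by
  intro L
  induction L generalizing t with
  | nil => exact fun sub h => ⟨_, by simpa [queryAll] using h⟩
  | cons i L ih =>
    intro sub h
    rw [queryAll, DTree.depth] at h
    have h' : t - 1 ≤ max (queryAll L fun v => sub (Function.update v i false)).depth
      (queryAll L fun v => sub (Function.update v i true)).depth := by omega
    rcases le_max_iff.1 h' with h' | h'
    · obtain ⟨v, hv⟩ := ih _ h'
      exact ⟨Function.update v i false, by rw [List.length_cons]; omega⟩
    · obtain ⟨v, hv⟩ := ih _ h'
      exact ⟨Function.update v i true, by rw [List.length_cons]; omega⟩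

/-- A tree of depth at least `t ≤ R * ℓ` has a branch along which at most `R` formulas are followed
until `t` variables are queried, because each but the last accounts for more than `ℓ` queries. The
list `𝓖` is filled up to length `R` with formulas that are not reached. -/
theorem exists_reaches_of_isCCDT {k ℓ : ℕ} {𝓗 : List (CNF n)} {T : DTree n Unit}
    (h : IsCCDT k ℓ 𝓗 T) (ρ : Restriction n) :
    ∀ (𝓕 : List (CNF n)) (A : Restriction n) (t R : ℕ),
      𝓗 = 𝓕.map (CNF.restrict (extend ρ A)) → 1 ≤ t → t ≤ T.depth → t ≤ R * ℓ →
      ∃ 𝓖 : List (CNF n), 𝓖.length = R ∧ (∀ F ∈ 𝓖, F ∈ 𝓕) ∧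
        ∃ w, Reaches ρ t ⟨𝓖, A, A⟩ w := by
  induction h with
  | nil =>
    intro 𝓕 A t R _ ht hT
    simp only [DTree.depth] at hT
    omega
  | skip H 𝓗 T hF hT ih =>
    intro 𝓕 A t R h𝓕 ht htT hR
    obtain ⟨F, 𝓕, rfl, rfl, rfl⟩ := List.map_eq_cons_iff.1 h𝓕.symm
    obtain ⟨𝓖, h1, h2, h3⟩ := ih 𝓕 A t R rfl ht htT hR
    exact ⟨𝓖, h1, fun G hG => List.mem_cons_of_mem _ (h2 G hG), h3⟩
  | branch H 𝓗 η sub hF hη hlo hhi hsub ih =>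
    intro 𝓕 A t R h𝓕 ht htT hR
    obtain ⟨F, 𝓕, rfl, rfl, rfl⟩ := List.map_eq_cons_iff.1 h𝓕.symm
    obtain ⟨v, hv⟩ := exists_le_depth_queryAll _ _ htT
    rw [List.length_map] at hv
    obtain ⟨R, rfl⟩ : ∃ R', R = R' + 1 :=
      Nat.exists_eq_succ_of_ne_zero (by rintro rfl; omega)
    have hne : η ≠ [] := by
      rintro rfl
      simp at hlo
    rw [Nat.add_mul] at hR
    by_cases hlt : η.length < t
    · obtain ⟨𝓖, h1, h2, w, hw⟩ := ih v (F :: 𝓕)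
        (extend A (fixOn (η.map Prod.fst).toFinset v)) (t - η.length) R
        (by rw [← List.map_cons, List.map_map]
            congr 1
            funext G
            rw [Function.comp_apply, CNF.restrict_restrict, extend_assoc])
        (by omega) (by omega) (by omega)
      exact ⟨F :: 𝓖, by simp [h1], List.forall_mem_cons.2 ⟨by simp, h2⟩,
        exists_reaches_of_isFullPath hη ρ F 𝓖 _ v A A t rfl hne ht rfl fun _ => ⟨w, hw⟩⟩
    · exact ⟨F :: List.replicate R F, by simp,
        List.forall_mem_cons.2 ⟨by simp, fun G hG => by simp [List.eq_of_mem_replicate hG]⟩,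
        exists_reaches_of_isFullPath hη ρ F _ _ v A A t rfl hne ht rfl fun h => absurd h hlt⟩

theorem exists_isCCDT_of_le_ccdtDepth {k ℓ t : ℕ} {𝓗 : List (CNF n)} (ht : 1 ≤ t)
    (h : (t : ℕ∞) ≤ ccdtDepth k ℓ 𝓗) : ∃ T, IsCCDT k ℓ 𝓗 T ∧ t ≤ T.depth := by
  by_contra! hc
  have h1 : ccdtDepth k ℓ 𝓗 ≤ ((t - 1 : ℕ) : ℕ∞) :=
    iSup₂_le fun T hT => by
      have := hc T hT
      exact_mod_cast (by omega : T.depth ≤ t - 1)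
  have h2 : t ≤ t - 1 := by exact_mod_cast h.trans h1
  omega

theorem IsFullPath.mem_vars {H : CNF n} {η : List (Fin n × Bool)} (h : IsFullPath H η) :
    ∀ i ∈ η.map Prod.fst, ∃ C ∈ H, i ∈ Clause.vars C := by
  induction h with
  | nil => simp
  | segment H C v η h0 hC hη ih =>
    intro i hi
    rw [List.map_append, List.mem_append, List.map_map] at hi
    rcases hi with hi | hi
    · refine ⟨C, List.mem_of_find?_eq_some hC, Clause.mem_varList.1 ?_⟩
      simpa [Function.comp_def] using hi
    · obtain ⟨D', hD', hi⟩ := ih i hi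
      obtain ⟨D, hD, rfl⟩ := List.mem_map.1 hD'
      exact ⟨D, hD, (Clause.mem_vars_restrict hi).1⟩

theorem IsFullPath.nodup {H : CNF n} {η : List (Fin n × Bool)} (h : IsFullPath H η) :
    (η.map Prod.fst).Nodup := by
  induction h with
  | nil => simp
  | segment H C v η h0 hC hη ih =>
    have hmap : ((Clause.varList C).map fun i => (i, v i)).map Prod.fst = Clause.varList C := by
      simp [Function.comp_def]
    rw [List.map_append, hmap, List.nodup_append']
    refine ⟨Finset.sort_nodup _ _, ih, fun i hi hi' => ?_⟩
    obtain ⟨D', hD', hiD⟩ := hη.mem_vars i hi'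
    obtain ⟨D, hD, rfl⟩ := List.mem_map.1 hD'
    have := (Clause.mem_vars_restrict hiD).2
    rw [Clause.mem_varList] at hi
    simp [fixOn, hi] at this

/-- A common partial decision tree that makes a query does so along a full path, whose more than
`ℓ` variables are distinct. -/
theorem IsCCDT.lt_of_depth_pos {k ℓ : ℕ} {𝓗 : List (CNF n)} {T : DTree n Unit}
    (h : IsCCDT k ℓ 𝓗 T) (hT : 1 ≤ T.depth) : ℓ < n ∧ 𝓗 ≠ [] := by
  induction h with
  | nil => simp [DTree.depth] at hT
  | skip H 𝓗 T hF hT' ih => exact ⟨(ih hT).1, by simp⟩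
  | branch H 𝓗 η sub hF hη hlo hhi hsub ih =>
    have := hη.nodup.length_le_card
    rw [List.length_map, Fintype.card_fin] at this
    exact ⟨by omega, by simp⟩

end

/-! ### Small circuits that test whether a list of segments occurs -/

section
variable {ι : Type}

theorem IsOrAnd.mono {b c : ℕ} {f : (ι → Bool) → Prop} (hf : IsOrAnd b f) (h : b ≤ c) :
    IsOrAnd c f := by
  obtain ⟨u, hu, hx⟩ := hf
  exact ⟨u, hu.trans h, hx⟩

theorem IsAndOrAnd.mono {a a' b b' : ℕ} {f : (ι → Bool) → Prop} (hf : IsAndOrAnd a b f)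
    (ha : a ≤ a') (hb : b ≤ b') : IsAndOrAnd a' b' f := by
  obtain ⟨Φ, h1, h2, h3⟩ := hf
  exact ⟨Φ, h1.trans ha, fun u hu => (h2 u hu).trans hb, h3⟩

/-- A condition on the first element with `p`, as a conjunction over all elements. -/
theorem exists_find?_iff {α : Type} [DecidableEq α] (p : α → Bool) (R : α → Prop) (L : List α) :
    (∃ D, L.find? p = some D ∧ R D) ↔ (∃ D ∈ L, p D = true) ∧
      ∀ D ∈ L, (p D = false ∨ R D) ∨ ∃ E ∈ L.takeWhile (fun E => decide (E ≠ D)), p E = true := by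
  induction L with
  | nil => simp
  | cons a L ih =>
    rcases ha : p a with _ | _
    · rw [List.find?_cons_of_neg (by simp [ha]), ih, List.exists_mem_cons_iff, ha,
        List.forall_mem_cons]
      simp only [Bool.false_eq_true, false_or, ha, true_or, true_and]
      refine and_congr_right fun _ => forall₂_congr fun D _ => ?_
      by_cases h : a = D
      · subst h; simp [ha]
      · rw [List.takeWhile_cons_of_pos (by simpa using h), List.exists_mem_cons_iff, ha]
        simp
    · rw [List.find?_cons_of_pos ha]
      constructor
      · rintro ⟨D, hD, hR⟩
        obtain rfl : a = D := by simpa using hD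
        refine ⟨⟨a, by simp, ha⟩, fun D _ => ?_⟩
        by_cases h : a = D
        · subst h; exact Or.inl (Or.inr hR)
        · rw [List.takeWhile_cons_of_pos (by simpa using h)]
          exact Or.inr ⟨a, by simp, ha⟩
      · rintro ⟨-, h⟩
        have := h a (by simp)
        rw [List.takeWhile_cons_of_neg (by simp)] at this
        simp only [ha] at this
        exact ⟨a, rfl, by simpa using this⟩

/-- Deleting all but the first occurrence of each element changes no search. -/
theorem exists_nodup_find?_eq {α : Type} [DecidableEq α] (L : List α) :
    ∃ L' : List α, L'.Nodup ∧ (∀ a ∈ L', a ∈ L) ∧ ∀ p, L'.find? p = L.find? p := by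
  induction L with
  | nil => exact ⟨[], by simp, by simp, fun _ => rfl⟩
  | cons a L ih =>
    obtain ⟨L', h1, h2, h3⟩ := ih
    refine ⟨a :: L'.filter (fun b => decide (b ≠ a)), ?_, ?_, fun p => ?_⟩
    · exact List.nodup_cons.2 ⟨by simp, h1.filter _⟩
    · exact fun b hb => (List.mem_cons.1 hb).elim (fun h => by simp [h])
        fun h => List.mem_cons_of_mem _ (h2 b (List.mem_filter.1 h).1)
    · rcases ha : p a with _ | _
      · rw [List.find?_cons_of_neg (by simp [ha]), List.find?_cons_of_neg (by simp [ha]), ← h3,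
          List.find?_filter]
        congr 1
        funext b
        by_cases hb : b = a
        · subst hb; simp [ha]
        · simp [hb]
      · rw [List.find?_cons_of_pos ha, List.find?_cons_of_pos ha]

variable {n q : ℕ}

/-- A literal, as an element of a sum of standard finite types. -/
def Lit.toSum : Lit n → Bool ⊕ Fin n ⊕ Fin n
  | .const b => .inl b
  | .pos i => .inr (.inl i)
  | .neg i => .inr (.inr i)

theorem Lit.toSum_injective : Function.Injective (Lit.toSum (n := n)) := by
  rintro (_ | _ | _) (_ | _ | _) h <;> simp_all [Lit.toSum]

theorem length_le_of_nodup_clauses {k : ℕ} {F : CNF n} (hF : F.Nodup)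
    (hk : ∀ C ∈ F, C.length ≤ k) : F.length ≤ (2 * n + 3) ^ k := by
  classical
  have hcard : Fintype.card (Fin k → Option (Bool ⊕ Fin n ⊕ Fin n)) = (2 * n + 3) ^ k := by
    simp only [Fintype.card_fun, Fintype.card_option, Fintype.card_sum, Fintype.card_bool,
      Fintype.card_fin]
    congr 1
    omega
  rw [← List.toFinset_card_of_nodup hF, ← hcard, ← Finset.card_univ]
  refine Finset.card_le_card_of_injOn (fun C j => C[(j : ℕ)]?.map Lit.toSum)
    (fun _ _ => Finset.mem_coe.2 (Finset.mem_univ _)) fun C hC D hD h => ?_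
  -- a clause is determined by its entries at the positions below `k`, with `none` past its end
  have hC' := hk C (by simpa using hC)
  have hD' := hk D (by simpa using hD)
  refine List.ext_getElem? fun j => ?_
  by_cases hj : j < k
  · exact Option.map_injective Lit.toSum_injective (congrFun h ⟨j, hj⟩)
  · rw [List.getElem?_eq_none (by omega), List.getElem?_eq_none (by omega)]

/-- The bits that determine the restriction of the variables of `D`. -/
def clauseBits (q : ℕ) (D : Clause n) : Finset (EncIndex n q) :=
  (Clause.vars D ×ˢ Finset.univ).disjSum (Clause.vars D)

theorem card_clauseBits (D : Clause n) :
    (clauseBits q D).card = (Clause.vars D).card * (q + 1) := by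
  simp [clauseBits, Finset.card_disjSum, Nat.mul_add]

theorem restrict_congr_of_clauseBits (A : Restriction n) (D : Clause n)
    {z z' : EncIndex n q → Bool} (h : ∀ e ∈ clauseBits q D, z e = z' e) :
    Clause.restrict (extend (decodeRestriction z) A) D =
      Clause.restrict (extend (decodeRestriction z') A) D := by
  have hdec : ∀ i ∈ Clause.vars D, decodeRestriction z i = decodeRestriction z' i := by
    intro i hi
    have h1 : ∀ j : Fin q, z (.inl (i, j)) = z' (.inl (i, j)) := fun j =>
      h _ (by simpa [clauseBits] using hi)
    have h2 : z (.inr i) = z' (.inr i) := h _ (by simpa [clauseBits] using hi)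
    simp only [decodeRestriction, h1, h2]
  refine List.map_congr_left fun l hl => ?_
  cases l with
  | const b => rfl
  | pos i =>
    have := hdec i (Clause.mem_vars.2 ⟨_, hl, by simp [Lit.vars]⟩)
    simp [Lit.restrict, extend, this]
  | neg i =>
    have := hdec i (Clause.mem_vars.2 ⟨_, hl, by simp [Lit.vars]⟩)
    simp [Lit.restrict, extend, this]

theorem isOrAnd_clause {k : ℕ} (A : Restriction n) {D : Clause n} (hD : D.length ≤ k)
    (P : Clause n → Prop) : IsOrAnd (2 ^ (k * (q + 1))) fun z : EncIndex n q → Bool =>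
      P (Clause.restrict (extend (decodeRestriction z) A) D) :=
  isOrAnd_of_dependsOn (clauseBits q D)
    (by rw [card_clauseBits]; exact Nat.mul_le_mul_right _ ((Clause.card_vars_le D).trans hD)) _
    fun z z' h => by rw [restrict_congr_of_clauseBits A D h]

/-- A condition on the first live clause of a `k`-CNF under a restriction and a fixed continuation
is an AND of ORs of conjunctions: some clause is not constantly `1`, and every clause is constantly
`1`, or satisfies the condition, or comes after a clause that is not constantly `1`. -/
theorem isAndOrAnd_firstLive {k : ℕ} (A : Restriction n) {F : CNF n}
    (hF : ∀ C ∈ F, C.length ≤ k) (P : Clause n → Prop) :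
    IsAndOrAnd ((2 * n + 3) ^ k + 1) (((2 * n + 3) ^ k + 2) * 2 ^ (k * (q + 1)))
      fun z : EncIndex n q → Bool => ∃ C,
        (CNF.restrict (extend (decodeRestriction z) A) F).firstLive = some C ∧ P C := by
  obtain ⟨L, h1, h2, h3⟩ := exists_nodup_find?_eq F
  have hLk : ∀ C ∈ L, C.length ≤ k := fun C hC => hF C (h2 C hC)
  have hlen : L.length ≤ (2 * n + 3) ^ k := length_le_of_nodup_clauses h1 hLk
  have hdead : ∀ D ∈ L, IsOrAnd (2 ^ (k * (q + 1))) fun z : EncIndex n q → Bool =>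
      (!Clause.isOne (Clause.restrict (extend (decodeRestriction z) A) D)) = true :=
    fun D hD => isOrAnd_clause A (hLk D hD) fun C => (!Clause.isOne C) = true
  have hfirst : ∀ D ∈ L, IsOrAnd (((2 * n + 3) ^ k + 2) * 2 ^ (k * (q + 1)))
      fun z : EncIndex n q → Bool =>
        ((!Clause.isOne (Clause.restrict (extend (decodeRestriction z) A) D)) = false ∨
          P (Clause.restrict (extend (decodeRestriction z) A) D)) ∨
        ∃ E ∈ L.takeWhile (fun E => decide (E ≠ D)),
          (!Clause.isOne (Clause.restrict (extend (decodeRestriction z) A) E)) = true := by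
    intro D hD
    have hT := (L.takeWhile_prefix fun E => decide (E ≠ D)).sublist
    refine IsOrAnd.mono (((isOrAnd_clause A (hLk D hD) fun C => (!Clause.isOne C) = false).or
      (isOrAnd_clause A (hLk D hD) P)).or
      (IsOrAnd.exists_mem _ _ fun E hE => hdead E (hT.subset hE))) ?_
    have := Nat.mul_le_mul_right (2 ^ (k * (q + 1))) (hT.length_le.trans hlen)
    rw [Nat.add_mul]
    omega
  have hall := (((IsOrAnd.exists_mem _ L hdead).mono (c := ((2 * n + 3) ^ k + 2) *
    2 ^ (k * (q + 1))) (Nat.mul_le_mul_right _ (by omega))).isAndOrAnd.and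
    (IsAndOrAnd.forall_mem _ L hfirst)).mono (a' := (2 * n + 3) ^ k + 1) (by omega) le_rfl
  refine hall.congr fun z => ?_
  rw [← exists_find?_iff, h3]
  simp only [CNF.firstLive, CNF.restrict, List.find?_map, Option.map_eq_some_iff]
  constructor
  · rintro ⟨_, ⟨D, hD, rfl⟩, hP⟩
    exact ⟨D, hD, hP⟩
  · rintro ⟨D, hD, hP⟩
    exact ⟨_, ⟨D, hD, rfl⟩, hP⟩

theorem State.formula_clause_length {k : ℕ} {st : State n}
    (h : ∀ F ∈ st.formulas, ∀ C ∈ F, C.length ≤ k) : ∀ C ∈ st.formula, C.length ≤ k := by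
  unfold State.formula
  rcases hf : st.formulas with _ | ⟨F, 𝓖⟩
  · simp
  · exact h F (by simp [hf])

theorem State.formulas_next_clause_length {k : ℕ} {st : State n} (s : Segment n)
    (h : ∀ F ∈ st.formulas, ∀ C ∈ F, C.length ≤ k) :
    ∀ F ∈ (st.next s).formulas, ∀ C ∈ F, C.length ≤ k := by
  unfold State.next
  split_ifs
  · exact fun F hF => h F (List.mem_of_mem_tail hF)
  · exact h

theorem isAndOrAnd_reaches {k t : ℕ} {w : List (Segment n)} (hw : ∀ s ∈ w, s.1 ≠ [])
    (hwt : segSize w < t) {st : State n} (h : ∀ F ∈ st.formulas, ∀ C ∈ F, C.length ≤ k) :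
    IsAndOrAnd ((w.length + 1) * ((2 * n + 3) ^ k + 1))
      (((2 * n + 3) ^ k + 2) * 2 ^ (k * (q + 1)))
      fun z : EncIndex n q → Bool => Reaches (decodeRestriction z) t st w := by
  have key : ∀ (w : List (Segment n)) (st : State n) (P : Clause n → Prop),
      (∀ F ∈ st.formulas, ∀ C ∈ F, C.length ≤ k) →
      IsAndOrAnd ((w.length + 1) * ((2 * n + 3) ^ k + 1))
        (((2 * n + 3) ^ k + 2) * 2 ^ (k * (q + 1)))
        fun z : EncIndex n q → Bool => Along (Live (decodeRestriction z)) st w ∧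
          ∃ C, (CNF.restrict (extend (decodeRestriction z) (w.foldl State.next st).path)
            (w.foldl State.next st).formula).firstLive = some C ∧ P C := by
    intro w
    induction w with
    | nil =>
      intro st P hst
      refine ((isAndOrAnd_firstLive st.path (State.formula_clause_length hst) P).mono
        (by simp) le_rfl).congr fun z => ?_
      simp [Along]
    | cons s w ih =>
      intro st P hst
      refine (((isAndOrAnd_firstLive st.path (State.formula_clause_length hst)
        fun C => Clause.varList C = s.vars).and (ih (st.next s) P
          (State.formulas_next_clause_length s hst))).mono (Nat.le_of_eq ?_) le_rfl).congr
        fun z => ?_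
      · rw [List.length_cons]; ring
      · rw [Along, and_assoc]; rfl
  refine (key w st (fun C => t ≤ segSize w + (Clause.varList C).length) h).congr fun z => ?_
  unfold Reaches
  simp only [hwt, true_and, and_congr_left_iff]
  exact fun _ => and_iff_right hw

end

/-! ### Live clauses and falsified clauses -/

section
variable {n : ℕ}

/-- The assignment that takes the values of `A`, and those of `y` where `A` is undefined. -/
def complete (A : Restriction n) (y : Fin n → Bool) : Fin n → Bool := fun i => (A i).getD (y i)

/-- The variables of the first clause of `F` that is false at `z`. -/
def falseVars (F : CNF n) (z : Fin n → Bool) : Finset (Fin n) :=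
  ((F.find? fun D => !Clause.eval z D).map Clause.vars).getD ∅

/-- The variables of the segment `s` occur in the first clause of the current formula that is false
at the assignment `y`, updated by the values on the path. -/
def Falsified (y : Fin n → Bool) (st : State n) (s : Segment n) : Prop :=
  ∀ i ∈ s.vars, i ∈ falseVars st.formula (complete st.path y)

theorem Clause.eval_congr {C : Clause n} {x y : Fin n → Bool}
    (h : ∀ i ∈ Clause.vars C, x i = y i) : Clause.eval x C = Clause.eval y C := by
  have key : ∀ l ∈ C, Lit.eval x l = Lit.eval y l := by
    intro l hl
    cases l with
    | const b => rfl
    | pos i => exact h i (Clause.mem_vars.2 ⟨_, hl, by simp [Lit.vars]⟩)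
    | neg i => exact congrArg Bool.not (h i (Clause.mem_vars.2 ⟨_, hl, by simp [Lit.vars]⟩))
  rw [Bool.eq_iff_iff, Clause.eval, Clause.eval, List.any_eq_true, List.any_eq_true]
  exact exists_congr fun l => and_congr_right fun hl => by rw [key l hl]

theorem Clause.eval_restrict (A : Restriction n) (y : Fin n → Bool) (C : Clause n) :
    Clause.eval y (Clause.restrict A C) = Clause.eval (complete A y) C := by
  have : ∀ l : Lit n, Lit.eval y (l.restrict A) = Lit.eval (complete A y) l := by
    rintro (b | i | i)
    · rfl
    · rcases h : A i with _ | b <;> simp [Lit.restrict, Lit.eval, complete, h]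
    · rcases h : A i with _ | b <;> simp [Lit.restrict, Lit.eval, complete, h]
  rw [Clause.eval, Clause.restrict, List.any_map, Clause.eval]
  congr 1
  funext l
  exact this l

theorem Segment.pathVals_eq_none {s : Segment n} {i : Fin n} :
    s.pathVals i = none ↔ i ∉ s.vars := by
  simp [Segment.pathVals, Segment.vars, List.lookup_eq_none_iff]
  grind

theorem Segment.branchVals_eq_none {s : Segment n} {i : Fin n} :
    s.branchVals i = none ↔ i ∉ s.vars := by
  simp [Segment.branchVals, Segment.vars, List.lookup_eq_none_iff]
  grind

/-- The path and the branch assign the same variables, all left free by `ρ`. -/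
def State.Fits (ρ : Restriction n) (st : State n) : Prop :=
  ∀ i, (st.path i = none ↔ st.branch i = none) ∧ (st.path i ≠ none → ρ i = none)

theorem Live.free {ρ : Restriction n} {st : State n} {s : Segment n} (h : Live ρ st s) :
    s.vars.Nodup ∧ ∀ i ∈ s.vars, ρ i = none ∧ st.path i = none := by
  obtain ⟨C, hC, hs⟩ := h
  rw [← hs]
  refine ⟨Finset.sort_nodup _ _, fun i hi => ?_⟩
  obtain ⟨D, hD, rfl⟩ := List.mem_map.1 (List.mem_of_find?_eq_some hC)
  exact extend_eq_none.1 (Clause.mem_vars_restrict (Clause.mem_varList.1 hi)).2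

theorem State.next_path_eq_none {ρ : Restriction n} {st : State n} (hst : st.Fits ρ)
    (s : Segment n) (i : Fin n) :
    (st.next s).path i = none ↔ st.path i = none ∧ i ∉ s.vars := by
  unfold State.next
  split_ifs
  · rw [extend_eq_none, Segment.branchVals_eq_none, (hst i).1]
  · rw [extend_eq_none, Segment.pathVals_eq_none]

theorem State.next_branch_eq_none {st : State n} (s : Segment n) (i : Fin n) :
    (st.next s).branch i = none ↔ st.branch i = none ∧ i ∉ s.vars := by
  unfold State.next
  split_ifs <;> rw [extend_eq_none, Segment.branchVals_eq_none]

theorem State.Fits.next {ρ : Restriction n} {st : State n} {s : Segment n} (hst : st.Fits ρ)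
    (hs : Live ρ st s) : (st.next s).Fits ρ := by
  refine fun i => ⟨?_, fun h => ?_⟩
  · rw [State.next_path_eq_none hst, State.next_branch_eq_none, (hst i).1]
  · rw [Ne, State.next_path_eq_none hst, not_and_or, not_not] at h
    exact h.elim (hst i).2 fun h => (hs.free.2 i h).1

/-- The variables of a list of segments. -/
def segVars (w : List (Segment n)) : List (Fin n) := w.flatMap Segment.vars

theorem segVars_cons (s : Segment n) (w : List (Segment n)) :
    segVars (s :: w) = s.vars ++ segVars w :=
  rfl

theorem length_segVars (w : List (Segment n)) : (segVars w).length = segSize w := by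
  simp [segVars, segSize, List.length_flatMap, Segment.vars]

theorem free_of_along_live {ρ : Restriction n} :
    ∀ {w : List (Segment n)} {st : State n}, st.Fits ρ → Along (Live ρ) st w →
      (segVars w).Nodup ∧ ∀ i ∈ segVars w, ρ i = none ∧ st.path i = none
  | [], _, _, _ => by simp [segVars]
  | s :: w, st, hst, ⟨hs, hw⟩ => by
    obtain ⟨h1, h2⟩ := free_of_along_live (hst.next hs) hw
    obtain ⟨h3, h4⟩ := hs.free
    have h5 : ∀ i ∈ segVars w, st.path i = none ∧ i ∉ s.vars := fun i hi =>
      (State.next_path_eq_none hst s i).1 (h2 i hi).2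
    rw [segVars_cons]
    refine ⟨List.nodup_append'.2 ⟨h3, h1, fun i hi hi' => (h5 i hi').2 hi⟩, fun i hi => ?_⟩
    rcases List.mem_append.1 hi with hi | hi
    · exact h4 i hi
    · exact ⟨(h2 i hi).1, (h5 i hi).1⟩

theorem along_falsified_congr {y y' : Fin n → Bool} :
    ∀ {w : List (Segment n)} {st : State n},
      (∀ i, st.path i = none ∨ st.branch i = none → y i = y' i) →
      Along (Falsified y) st w → Along (Falsified y') st w
  | [], _, _, _ => trivial
  | s :: w, st, h, ⟨hs, hw⟩ => by
    have hc : complete st.path y = complete st.path y' := by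
      funext i
      rcases hi : st.path i with _ | b
      · simp [complete, hi, h i (Or.inl hi)]
      · simp [complete, hi]
    refine ⟨fun i hi => hc ▸ hs i hi, along_falsified_congr (fun i hi => h i ?_) hw⟩
    unfold State.next at hi
    split_ifs at hi
    · simp only [extend_eq_none, or_self] at hi
      exact Or.inr hi.1
    · simp only [extend_eq_none] at hi
      exact hi.imp And.left And.left

/-- If the segments `w` are live under `ρ`, then every assignment that agrees with `ρ` can be
changed on the variables of `w`, so that each queried clause becomes false until it is queried.
Since the clauses before the first live one are constantly `1`, the queried clause then is the
first false one. -/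
theorem exists_along_falsified {ρ : Restriction n} (y : Fin n → Bool)
    (hy : ∀ i b, ρ i = some b → y i = b) :
    ∀ {w : List (Segment n)} {st : State n}, st.Fits ρ → Along (Live ρ) st w →
      ∃ y' : Fin n → Bool, (∀ i, i ∉ segVars w → y' i = y i) ∧ Along (Falsified y') st w
  | [], _, _, _ => ⟨y, fun _ _ => rfl, trivial⟩
  | s :: w, st, hst, ⟨hs, hw⟩ => by
    obtain ⟨y₁, h1, h2⟩ := exists_along_falsified y hy (hst.next hs) hw
    have hfree := (free_of_along_live (hst.next hs) hw).2
    obtain ⟨C, hC, hCs⟩ := id hs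
    have hmem : ∀ i, i ∈ s.vars ↔ i ∈ Clause.vars C := fun i => by rw [← hCs, Clause.mem_varList]
    obtain ⟨hC1, L₁, L₂, hL, hL₁⟩ := List.find?_eq_some_iff_append.1 hC
    obtain ⟨M₁, M₂', hM, rfl, hM₂⟩ := List.map_eq_append_iff.1 hL
    obtain ⟨D, M₂, rfl, rfl, rfl⟩ := List.map_eq_cons_iff.1 hM₂
    obtain ⟨x, hx⟩ : ∃ x, Clause.eval x (Clause.restrict (extend ρ st.path) D) = false := by
      simpa [Clause.isOne] using hC1
    refine ⟨fun i => if i ∈ s.vars then x i else y₁ i, fun i hi => ?_, fun i hi => ?_, ?_⟩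
    · rw [segVars_cons, List.mem_append, not_or] at hi
      exact (if_neg hi.1).trans (h1 i hi.2)
    · set y' : Fin n → Bool := fun i => if i ∈ s.vars then x i else y₁ i with hy'
      have hcomp : complete (extend ρ st.path) y' = complete st.path y' := by
        funext j
        rcases hj : ρ j with _ | b
        · simp [complete, extend, hj]
        · have hA : st.path j = none := by
            by_contra hA
            rw [(hst j).2 hA] at hj
            cases hj
          have h3 : j ∉ s.vars := fun h => by
            rw [(hs.free.2 j h).1] at hj
            cases hj
          have h4 : j ∉ segVars w := fun h => by
            rw [(hfree j h).1] at hj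
            cases hj
          simp [complete, extend, hj, hA, hy', h3, h1 j h4, hy j b hj]
      -- the clause `D` is false, and the earlier ones are true, at the changed assignment
      have hD : Clause.eval (complete st.path y') D = false := by
        rw [← hcomp, ← Clause.eval_restrict, ← hx]
        exact Clause.eval_congr fun j hj => by rw [hy']; simp [(hmem j).2 hj]
      have hfind : st.formula.find? (fun D => !Clause.eval (complete st.path y') D) = some D := by
        refine List.find?_eq_some_iff_append.2 ⟨by simp [hD], M₁, M₂, hM, fun E hE => ?_⟩
        have := hL₁ _ (List.mem_map_of_mem hE)
        simp only [Bool.not_not, Clause.isOne, decide_eq_true_eq] at this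
        rw [Bool.not_not, ← hcomp, ← Clause.eval_restrict]
        exact this y'
      rw [falseVars, hfind]
      exact (Clause.mem_vars_restrict ((hmem i).1 hi)).1
    · refine along_falsified_congr (fun i hi => ?_) h2
      have : i ∉ s.vars := by
        rw [State.next_path_eq_none hst, State.next_branch_eq_none] at hi
        exact hi.elim And.right And.right
      exact (if_neg this).symm

/-! ### Counting lists of segments -/

/-- The encoding of a segment as a list of symbols, where `g` encodes the variables. The last
symbol is marked as such, and also carries the flag of the segment. -/
def encodeSegment {κ : Type} (g : Fin n → κ) (e : Bool) :
    List (Fin n × Bool × Bool) → List (κ × Bool × Bool × Option Bool)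
  | [] => []
  | [a] => [(g a.1, a.2.1, a.2.2, some e)]
  | a :: b :: L => (g a.1, a.2.1, a.2.2, none) :: encodeSegment g e (b :: L)

/-- The encoding of a list of segments; the encoding `g` of the variables may depend on the
position. -/
def encodeSegments {κ : Type} (g : State n → Fin n → κ) :
    State n → List (Segment n) → List (κ × Bool × Bool × Option Bool)
  | _, [] => []
  | st, s :: w => encodeSegment (g st) s.2 s.1 ++ encodeSegments g (st.next s) w

theorem length_encodeSegment {κ : Type} (g : Fin n → κ) (e : Bool) :
    ∀ L, (encodeSegment g e L).length = L.length
  | [] => rfl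
  | [_] => rfl
  | _ :: b :: L => by
    rw [encodeSegment, List.length_cons, length_encodeSegment g e (b :: L)]
    rfl

theorem length_encodeSegments {κ : Type} (g : State n → Fin n → κ) :
    ∀ (w : List (Segment n)) (st : State n), (encodeSegments g st w).length = segSize w
  | [], _ => rfl
  | s :: w, st => by
    rw [encodeSegments, List.length_append, length_encodeSegment, length_encodeSegments g w,
      segSize_cons]

/-- An encoded segment can be read off from the front of a list, because its end is marked. -/
theorem encodeSegment_append_inj {κ : Type} {g : Fin n → κ} {S : Set (Fin n)}
    (hg : Set.InjOn g S) {e e' : Bool} {r r' : List (κ × Bool × Bool × Option Bool)} :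
    ∀ L L' : List (Fin n × Bool × Bool), L ≠ [] → L' ≠ [] → (∀ a ∈ L, a.1 ∈ S) →
      (∀ a ∈ L', a.1 ∈ S) → encodeSegment g e L ++ r = encodeSegment g e' L' ++ r' →
      L = L' ∧ e = e' ∧ r = r'
  | [], _, h, _, _, _, _ => absurd rfl h
  | _ :: _, [], _, h, _, _, _ => absurd rfl h
  | [a], [a'], _, _, h1, h2, h => by
    simp only [encodeSegment, List.cons_append, List.nil_append, List.cons.injEq, Prod.mk.injEq,
      Option.some.injEq] at h
    have := hg (h1 a (by simp)) (h2 a' (by simp)) h.1.1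
    exact ⟨by rw [Prod.ext this (Prod.ext h.1.2.1 h.1.2.2.1)], h.1.2.2.2, h.2⟩
  | [a], a' :: b' :: L', _, _, _, _, h => by simp [encodeSegment] at h
  | a :: b :: L, [a'], _, _, _, _, h => by simp [encodeSegment] at h
  | a :: b :: L, a' :: b' :: L', _, _, h1, h2, h => by
    simp only [encodeSegment, List.cons_append, List.cons.injEq, Prod.mk.injEq] at h
    have h3 := hg (h1 a (by simp)) (h2 a' (by simp)) h.1.1
    obtain ⟨h4, h5, h6⟩ := encodeSegment_append_inj hg (b :: L) (b' :: L') (by simp) (by simp)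
      (fun c hc => h1 c (List.mem_cons_of_mem _ hc)) (fun c hc => h2 c (List.mem_cons_of_mem _ hc))
      h.2
    exact ⟨by rw [Prod.ext h3 (Prod.ext h.1.2.1 h.1.2.2.1), h4], h5, h6⟩

theorem encodeSegments_inj {κ : Type} {g : State n → Fin n → κ} {S : State n → Set (Fin n)}
    (hg : ∀ st, Set.InjOn (g st) (S st)) :
    ∀ (w w' : List (Segment n)) (st : State n), (∀ s ∈ w, s.1 ≠ []) → (∀ s ∈ w', s.1 ≠ []) →
      Along (fun st s => ∀ i ∈ s.vars, i ∈ S st) st w →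
      Along (fun st s => ∀ i ∈ s.vars, i ∈ S st) st w' →
      encodeSegments g st w = encodeSegments g st w' → w = w'
  | [], [], _, _, _, _, _, _ => rfl
  | [], s :: w, st, _, h1, _, _, h => by
    have := congrArg List.length h
    rw [length_encodeSegments, length_encodeSegments, segSize_cons] at this
    have h2 := List.length_pos_of_ne_nil (h1 s (by simp))
    simp only [segSize, List.map_nil, List.sum_nil] at this
    omega
  | s :: w, [], st, h1, _, _, _, h => by
    have := congrArg List.length h
    rw [length_encodeSegments, length_encodeSegments, segSize_cons] at this
    have h2 := List.length_pos_of_ne_nil (h1 s (by simp))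
    simp only [segSize, List.map_nil, List.sum_nil] at this
    omega
  | s :: w, s' :: w', st, h1, h2, ⟨h3, h4⟩, ⟨h5, h6⟩, h => by
    obtain ⟨h7, h8, h9⟩ := encodeSegment_append_inj (hg st) s.1 s'.1 (h1 s (by simp))
      (h2 s' (by simp)) (fun a ha => h3 _ (List.mem_map_of_mem ha))
      (fun a ha => h5 _ (List.mem_map_of_mem ha)) h
    obtain rfl : s = s' := Prod.ext h7 h8
    rw [encodeSegments_inj hg w w' (st.next s) (fun a ha => h1 a (List.mem_cons_of_mem _ ha))
      (fun a ha => h2 a (List.mem_cons_of_mem _ ha)) h4 h6 h9]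

/-- There are at most `(12 |κ|) ^ T` lists of segments with `T` variables, if at each position the
variables that may be queried are named by elements of `κ`: a variable also comes with its values
on the full path and on the branch, and with one of three marks at the end of a segment. -/
theorem finite_and_ncard_le {κ : Type} [Fintype κ] {g : State n → Fin n → κ}
    {S : State n → Set (Fin n)} (hg : ∀ st, Set.InjOn (g st) (S st)) (st : State n) (T : ℕ)
    {W : Set (List (Segment n))} (hW : ∀ w ∈ W, ((∀ s ∈ w, s.1 ≠ []) ∧ segSize w = T) ∧
      Along (fun st s => ∀ i ∈ s.vars, i ∈ S st) st w) :
    W.Finite ∧ W.ncard ≤ (12 * Fintype.card κ) ^ T := by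
  let f : W → List.Vector (κ × Bool × Bool × Option Bool) T := fun w =>
    ⟨encodeSegments g st w.1, (length_encodeSegments g w.1 st).trans (hW w.1 w.2).1.2⟩
  have hf : Function.Injective f := fun w w' h => Subtype.ext <|
    encodeSegments_inj hg w.1 w'.1 st (hW w.1 w.2).1.1 (hW w'.1 w'.2).1.1 (hW w.1 w.2).2
      (hW w'.1 w'.2).2 (congrArg Subtype.val h)
  have hcard : Nat.card (List.Vector (κ × Bool × Bool × Option Bool) T) =
      (12 * Fintype.card κ) ^ T := by
    rw [Nat.card_eq_fintype_card, card_vector]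
    simp only [Fintype.card_prod, Fintype.card_bool, Fintype.card_option]
    ring
  refine ⟨Set.finite_coe_iff.1 (Finite.of_injective f hf), ?_⟩
  rw [← hcard]
  exact Nat.card_le_card_of_injective f hf

end

/-! ### Counting under the uniform distribution -/

section
variable {n : ℕ}

theorem along_of_forall {P : State n → Segment n → Prop} (h : ∀ st s, P st s) :
    ∀ (w : List (Segment n)) (st : State n), Along P st w
  | [], _ => trivial
  | s :: w, st => ⟨h st s, along_of_forall h w (st.next s)⟩

theorem finite_segLists_and_ncard_le (n T : ℕ) :
    {w : List (Segment n) | (∀ s ∈ w, s.1 ≠ []) ∧ segSize w = T}.Finite ∧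
      {w : List (Segment n) | (∀ s ∈ w, s.1 ≠ []) ∧ segSize w = T}.ncard ≤ (12 * n) ^ T := by
  have h := finite_and_ncard_le (n := n) (κ := Fin n) (g := fun _ i => i)
    (S := fun _ => Set.univ) (fun _ _ _ _ _ h => h) ⟨[], fun _ => none, fun _ => none⟩ T
    (W := {w : List (Segment n) | (∀ s ∈ w, s.1 ≠ []) ∧ segSize w = T})
    fun w hw => ⟨hw, along_of_forall (fun _ _ _ _ => Set.mem_univ _) w _⟩
  rwa [Fintype.card_fin] at h

/-- The lists of nonempty segments with `T` variables altogether. -/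
noncomputable def segLists (n T : ℕ) : Finset (List (Segment n)) :=
  (finite_segLists_and_ncard_le n T).1.toFinset

theorem mem_segLists {T : ℕ} {w : List (Segment n)} :
    w ∈ segLists n T ↔ (∀ s ∈ w, s.1 ≠ []) ∧ segSize w = T := by
  simp [segLists]

theorem card_segLists_le (n T : ℕ) : (segLists n T).card ≤ (12 * n) ^ T := by
  rw [segLists, ← Set.ncard_eq_toFinset_card _ (finite_segLists_and_ncard_le n T).1]
  exact (finite_segLists_and_ncard_le n T).2

theorem card_biUnion_segLists_le {n t : ℕ} (hn : 2 ≤ n) :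
    ((Finset.range t).biUnion (segLists n)).card ≤ n ^ (5 * t) := by
  have h16 : 2 ^ 4 ≤ n ^ 4 := Nat.pow_le_pow_left hn 4
  calc ((Finset.range t).biUnion (segLists n)).card
      ≤ ∑ T ∈ Finset.range t, (segLists n T).card := Finset.card_biUnion_le
    _ ≤ ∑ T ∈ Finset.range t, (12 * n) ^ T := Finset.sum_le_sum fun T _ => card_segLists_le n T
    _ ≤ (12 * n) ^ t := (Nat.geomSum_lt (by omega) fun T hT => Finset.mem_range.1 hT).le
    _ ≤ (n ^ 5) ^ t := Nat.pow_le_pow_left (by nlinarith [pow_succ n 4]) t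
    _ = n ^ (5 * t) := (pow_mul n 5 t).symm

theorem length_le_segSize {w : List (Segment n)} (h : ∀ s ∈ w, s.1 ≠ []) :
    w.length ≤ segSize w := by
  induction w with
  | nil => simp
  | cons s w ih =>
    have h1 := List.length_pos_of_ne_nil (h s (by simp))
    have h2 := ih fun s hs => h s (List.mem_cons_of_mem _ hs)
    rw [List.length_cons, segSize_cons]
    omega

theorem card_falseVars_le {k : ℕ} {F : CNF n} (hF : ∀ C ∈ F, C.length ≤ k) (z : Fin n → Bool) :
    (falseVars F z).card ≤ k := by
  unfold falseVars
  rcases h : F.find? fun D => !Clause.eval z D with _ | D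
  · simp
  · exact (Clause.card_vars_le D).trans (hF D (List.mem_of_find?_eq_some h))

theorem exists_injOn_fin {k : ℕ} (hk : 1 ≤ k) (S : Finset (Fin n)) (hS : S.card ≤ k) :
    ∃ g : Fin n → Fin k, Set.InjOn g S := by
  obtain ⟨f⟩ := Function.Embedding.nonempty_of_card_le (α := S) (β := Fin k) (by simpa using hS)
  refine ⟨fun i => if h : i ∈ S then f ⟨i, h⟩ else ⟨0, hk⟩, fun i hi j hj h => ?_⟩
  rw [Finset.mem_coe] at hi hj
  simp only [hi, hj, dif_pos] at h
  exact congrArg Subtype.val (f.injective h)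

/-- For a fixed assignment, a variable of the first false clause of a `k`-CNF is named by its
position in the clause, so few lists of segments query false clauses only. -/
theorem card_filter_falsified_le {k : ℕ} (hk : 1 ≤ k) (y : Fin n → Bool) {st : State n}
    (hst : ∀ F ∈ st.formulas, ∀ C ∈ F, C.length ≤ k) (T : ℕ)
    [DecidablePred fun w => Along (Falsified y) st w] :
    ((segLists n T).filter fun w => Along (Falsified y) st w).card ≤ (12 * k) ^ T := by
  classical
  let S : State n → Finset (Fin n) := fun st =>
    if ∀ C ∈ st.formula, C.length ≤ k then falseVars st.formula (complete st.path y) else ∅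
  have hS : ∀ st, (S st).card ≤ k := by
    intro st
    unfold S
    split_ifs with h
    · exact card_falseVars_le h _
    · simp
  choose g hg using fun st => exists_injOn_fin hk (S st) (hS st)
  have hS' : ∀ (w : List (Segment n)) (st : State n),
      (∀ F ∈ st.formulas, ∀ C ∈ F, C.length ≤ k) → Along (Falsified y) st w →
      Along (fun st s => ∀ i ∈ s.vars, i ∈ (S st : Set (Fin n))) st w := by
    intro w
    induction w with
    | nil => exact fun _ _ _ => trivial
    | cons s w ih =>
      intro st hst h
      refine ⟨fun i hi => ?_, ih _ (State.formulas_next_clause_length s hst) h.2⟩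
      unfold S
      rw [if_pos (State.formula_clause_length hst)]
      exact h.1 i hi
  have h := (finite_and_ncard_le (S := fun st => (S st : Set (Fin n))) hg st T
    (W := ((segLists n T).filter fun w => Along (Falsified y) st w : Finset _)) fun w hw => by
      rw [Finset.mem_coe, Finset.mem_filter, mem_segLists] at hw
      exact ⟨hw.1, hS' w st hst hw.2⟩).2
  rwa [Set.ncard_coe_finset, Fintype.card_fin] at h

variable {q : ℕ}

theorem decodeRestriction_eq_none {z : EncIndex n q → Bool} {i : Fin n}
    (h : decodeRestriction z i = none) (j : Fin q) : z (.inl (i, j)) = true := by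
  unfold decodeRestriction at h
  split_ifs at h with h'
  exact h' j

theorem decodeRestriction_eq_some {z : EncIndex n q → Bool} {i : Fin n} {b : Bool}
    (h : decodeRestriction z i = some b) : z (.inr i) = b := by
  unfold decodeRestriction at h
  split_ifs at h with h'
  exact Option.some.inj h

open Classical in
/-- If the segments `w` with `T` variables are live under `(ϱ, y)`, then all bits of `ϱ` at these
variables are `1`, and an assignment that agrees with `y` at the other variables makes the queried
clauses false. -/
theorem card_live_mul_le (𝓖 : List (CNF n)) (w : List (Segment n)) :
    (Finset.univ.filter fun z : EncIndex n q → Bool =>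
        Along (Live (decodeRestriction z)) ⟨𝓖, fun _ => none, fun _ => none⟩ w).card *
        2 ^ (segSize w * q) ≤
      2 ^ (n * q) * (2 ^ segSize w * (Finset.univ.filter fun y : Fin n → Bool =>
        Along (Falsified y) ⟨𝓖, fun _ => none, fun _ => none⟩ w).card) := by
  set st : State n := ⟨𝓖, fun _ => none, fun _ => none⟩ with hst
  have hfits : ∀ ρ : Restriction n, st.Fits ρ := fun ρ i => by simp [hst]
  let A := {z : EncIndex n q → Bool // Along (Live (decodeRestriction z)) st w}
  let B := {y : Fin n → Bool // Along (Falsified y) st w}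
  let X := {i : Fin n // i ∈ (segVars w).toFinset}
  have hfree : ∀ z : A, (segVars w).Nodup ∧
      ∀ i ∈ segVars w, decodeRestriction z.1 i = none ∧ st.path i = none :=
    fun z => free_of_along_live (hfits _) z.2
  rcases isEmpty_or_nonempty A with hA | ⟨⟨z₀⟩⟩
  · have : (Finset.univ.filter fun z : EncIndex n q → Bool =>
        Along (Live (decodeRestriction z)) st w).card = 0 := by
      rw [← Fintype.card_subtype]
      exact Fintype.card_eq_zero
    rw [this, Nat.zero_mul]
    exact Nat.zero_le _
  · have hX : Fintype.card X = segSize w := by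
      rw [Fintype.card_coe, List.toFinset_card_of_nodup (hfree z₀).1, length_segVars]
    have hex : ∀ z : A, ∃ y : Fin n → Bool, (∀ i, i ∉ segVars w → y i = z.1 (.inr i)) ∧
        Along (Falsified y) st w := fun z =>
      exists_along_falsified (fun i => z.1 (.inr i)) (fun i b h => decodeRestriction_eq_some h)
        (hfits _) z.2
    choose Y hY1 hY2 using hex
    -- a pair of a live point and new bits of `ϱ` at the variables of `w` is determined by `ϱ` with
    -- these bits replaced, by `y` at the variables of `w`, and by the falsifying assignment
    let f : A × (X × Fin q → Bool) → (Fin n × Fin q → Bool) × (X → Bool) × B := fun a =>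
      (fun e => if h : e.1 ∈ (segVars w).toFinset then a.2 (⟨e.1, h⟩, e.2) else a.1.1 (.inl e),
        fun i => a.1.1 (.inr i.1), ⟨Y a.1, hY2 a.1⟩)
    have hf : Function.Injective f := by
      rintro ⟨z, c⟩ ⟨z', c'⟩ h
      simp only [f, Prod.mk.injEq] at h
      obtain ⟨h1, h2, h3⟩ := h
      have hc : c = c' := by
        funext ⟨i, j⟩
        simpa [i.2] using congrFun h1 (i.1, j)
      have hz : z.1 = z'.1 := by
        funext e
        rcases e with ⟨i, j⟩ | i
        · by_cases hi : i ∈ segVars w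
          · rw [decodeRestriction_eq_none ((hfree z).2 i hi).1,
              decodeRestriction_eq_none ((hfree z').2 i hi).1]
          · simpa [hi] using congrFun h1 (i, j)
        · by_cases hi : i ∈ segVars w
          · exact congrFun h2 ⟨i, List.mem_toFinset.2 hi⟩
          · rw [← hY1 z i hi, ← hY1 z' i hi]
            exact congrFun (congrArg Subtype.val h3) i
      rw [hc, Subtype.ext hz]
    have hcard := Fintype.card_le_of_injective f hf
    simpa only [Fintype.card_prod, Fintype.card_fun, Fintype.card_bool, Fintype.card_fin, hX,
      A, B, Fintype.card_subtype] using hcard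

open Classical in
theorem sum_card_live_mul_le {k : ℕ} (hk : 1 ≤ k) {𝓖 : List (CNF n)}
    (h𝓖 : ∀ F ∈ 𝓖, ∀ C ∈ F, C.length ≤ k) (T : ℕ) :
    (∑ w ∈ segLists n T, (Finset.univ.filter fun z : EncIndex n q → Bool =>
        Along (Live (decodeRestriction z)) ⟨𝓖, fun _ => none, fun _ => none⟩ w).card) *
        2 ^ (T * q) ≤ 2 ^ (n * q + n) * (24 * k) ^ T := by
  set st : State n := ⟨𝓖, fun _ => none, fun _ => none⟩ with hst
  have hswap : ∑ w ∈ segLists n T, (Finset.univ.filter fun y : Fin n → Bool =>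
      Along (Falsified y) st w).card =
      ∑ y : Fin n → Bool, ((segLists n T).filter fun w => Along (Falsified y) st w).card := by
    simp only [Finset.card_filter]
    exact Finset.sum_comm
  calc (∑ w ∈ segLists n T, (Finset.univ.filter fun z : EncIndex n q → Bool =>
        Along (Live (decodeRestriction z)) st w).card) * 2 ^ (T * q)
      = ∑ w ∈ segLists n T, (Finset.univ.filter fun z : EncIndex n q → Bool =>
        Along (Live (decodeRestriction z)) st w).card * 2 ^ (T * q) := Finset.sum_mul ..
    _ ≤ ∑ w ∈ segLists n T, 2 ^ (n * q) * (2 ^ T * (Finset.univ.filter fun y : Fin n → Bool =>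
        Along (Falsified y) st w).card) := Finset.sum_le_sum fun w hw => by
          have := card_live_mul_le (q := q) 𝓖 w
          rwa [(mem_segLists.1 hw).2] at this
    _ = 2 ^ (n * q) * (2 ^ T * ∑ y : Fin n → Bool,
        ((segLists n T).filter fun w => Along (Falsified y) st w).card) := by
          rw [← hswap, Finset.mul_sum, Finset.mul_sum]
    _ ≤ 2 ^ (n * q) * (2 ^ T * ∑ _y : Fin n → Bool, (12 * k) ^ T) := by
          gcongr with y
          exact card_filter_falsified_le hk y h𝓖 T
    _ = 2 ^ (n * q + n) * (24 * k) ^ T := by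
          rw [Finset.sum_const, Finset.card_univ, Fintype.card_fun, Fintype.card_bool,
            Fintype.card_fin, smul_eq_mul, show 24 * k = 2 * (12 * k) by ring, mul_pow 2, pow_add]
          ring

theorem State.mem_formulas_of_mem_next (w : List (Segment n)) :
    ∀ (st : State n), ∀ F ∈ (w.foldl State.next st).formulas, F ∈ st.formulas := by
  induction w with
  | nil => exact fun _ _ h => h
  | cons s w ih =>
    intro st F hF
    have h := ih (st.next s) F hF
    unfold State.next at h
    split_ifs at h
    · exact List.mem_of_mem_tail h
    · exact h

theorem State.exists_formula_of_firstLive {st : State n} {τ : Restriction n} {C : Clause n}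
    (h : (CNF.restrict τ st.formula).firstLive = some C) :
    ∃ F ∈ st.formulas, ∃ D ∈ F, C = Clause.restrict τ D := by
  obtain ⟨D, hD, rfl⟩ := List.mem_map.1 (List.mem_of_find?_eq_some h)
  unfold State.formula at hD
  rcases hf : st.formulas with _ | ⟨F, 𝓖⟩
  · simp [hf] at hD
  · exact ⟨F, by simp, D, by simpa [hf] using hD, rfl⟩

/-- The last step of `Reaches` can be carried out as one more segment. -/
theorem Reaches.exists_segment {ρ : Restriction n} {k t : ℕ} {st : State n}
    {w : List (Segment n)} (hst : ∀ F ∈ st.formulas, ∀ C ∈ F, C.length ≤ k)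
    (h : Reaches ρ t st w) :
    ∃ s : Segment n, s.1 ≠ [] ∧ Along (Live ρ) st (w ++ [s]) ∧ t ≤ segSize (w ++ [s]) ∧
      segSize (w ++ [s]) < t + k := by
  obtain ⟨⟨-, h2⟩, h3, C, hC, h4⟩ := h
  obtain ⟨F, hF, D, hD, rfl⟩ := State.exists_formula_of_firstLive hC
  set C := Clause.restrict (extend ρ (w.foldl State.next st).path) D with hCdef
  have hlen : (Clause.varList C).length ≤ k := by
    rw [Clause.length_varList]
    refine (Clause.card_vars_le C).trans ?_
    rw [hCdef, Clause.restrict, List.length_map]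
    exact hst F (State.mem_formulas_of_mem_next w st F hF) D hD
  set s := clauseSegment C (fun _ => false) (fun _ => false) false with hs
  have hsize : segSize (w ++ [s]) = segSize w + (Clause.varList C).length := by
    rw [segSize_append, segSize_cons, hs, length_clauseSegment]
    simp [segSize]
  refine ⟨s, fun h => ?_, along_append.2 ⟨h2, ⟨C, hC, (vars_clauseSegment ..).symm⟩, trivial⟩,
    by omega, by omega⟩
  rw [← length_clauseSegment C (fun _ => false) (fun _ => false) false, ← hs, h] at h4
  simp only [List.length_nil] at h4
  omega

open Classical in
theorem sum_card_reaches_le {k : ℕ} {𝓖 : List (CNF n)}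
    (h𝓖 : ∀ F ∈ 𝓖, ∀ C ∈ F, C.length ≤ k) (t : ℕ) :
    ∑ w ∈ (Finset.range t).biUnion (segLists n),
        (Finset.univ.filter fun z : EncIndex n q → Bool =>
          Reaches (decodeRestriction z) t ⟨𝓖, fun _ => none, fun _ => none⟩ w).card ≤
      ∑ T ∈ Finset.Ico t (t + k), ∑ w ∈ segLists n T,
        (Finset.univ.filter fun z : EncIndex n q → Bool =>
          Along (Live (decodeRestriction z)) ⟨𝓖, fun _ => none, fun _ => none⟩ w).card := by
  set st : State n := ⟨𝓖, fun _ => none, fun _ => none⟩ with hst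
  have hdisj : ((Finset.Ico t (t + k) : Finset ℕ) : Set ℕ).PairwiseDisjoint (segLists n) := by
    intro T _ T' _ hTT'
    refine Finset.disjoint_left.2 fun w hw hw' => hTT' ?_
    rw [← (mem_segLists.1 hw).2, ← (mem_segLists.1 hw').2]
  rw [← Finset.sum_biUnion hdisj, ← Finset.card_sigma, ← Finset.card_sigma]
  have hex : ∀ a : (_ : List (Segment n)) × (EncIndex n q → Bool), ∃ s : Segment n,
      Reaches (decodeRestriction a.2) t st a.1 → s.1 ≠ [] ∧
        Along (Live (decodeRestriction a.2)) st (a.1 ++ [s]) ∧ t ≤ segSize (a.1 ++ [s]) ∧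
        segSize (a.1 ++ [s]) < t + k := by
    intro a
    by_cases h : Reaches (decodeRestriction a.2) t st a.1
    · obtain ⟨s, hs⟩ := h.exists_segment h𝓖
      exact ⟨s, fun _ => hs⟩
    · exact ⟨([], false), fun h' => absurd h' h⟩
  choose s hs using hex
  -- appending the last segment is injective, since it can be removed again
  refine Finset.card_le_card_of_injOn (fun a => ⟨a.1 ++ [s a], a.2⟩) (fun a ha => ?_) ?_
  · rw [Finset.mem_coe, Finset.mem_sigma, Finset.mem_filter] at ha
    obtain ⟨h1, h2, h3, h4⟩ := hs a ha.2.2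
    rw [Finset.mem_coe, Finset.mem_sigma, Finset.mem_filter, Finset.mem_biUnion]
    refine ⟨⟨_, Finset.mem_Ico.2 ⟨h3, h4⟩, mem_segLists.2 ⟨fun s' hs' => ?_, rfl⟩⟩,
      Finset.mem_univ _, h2⟩
    rcases List.mem_append.1 hs' with h | h
    · exact ha.2.2.1.1 s' h
    · rw [List.mem_singleton.1 h]
      exact h1
  · rintro ⟨w, z⟩ - ⟨w', z'⟩ - h
    simp only [Sigma.mk.injEq, heq_eq_eq] at h
    obtain ⟨h, rfl⟩ := h
    rw [(List.append_inj' h rfl).1]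

end

/-! ### Probabilities -/

section
variable {Ω : Type} [Fintype Ω]

theorem prob_nonneg (D : PMF Ω) (A : Set Ω) : 0 ≤ prob D A :=
  Finset.sum_nonneg fun _ _ =>
    mul_nonneg ENNReal.toReal_nonneg (Set.indicator_nonneg (fun _ _ => zero_le_one) _)

theorem prob_le_one (D : PMF Ω) (A : Set Ω) : prob D A ≤ 1 := by
  have h1 : ∑ x, (D x).toReal = 1 := by
    have h := D.tsum_coe
    rw [tsum_fintype] at h
    rw [← ENNReal.toReal_sum fun x _ => D.apply_ne_top x, h, ENNReal.toReal_one]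
  rw [← h1]
  exact Finset.sum_le_sum fun x _ => mul_le_of_le_one_right ENNReal.toReal_nonneg
    (Set.indicator_le_self' (fun _ _ => zero_le_one) x)

theorem prob_le_sum {κ : Type} (D : PMF Ω) {A : Set Ω} (s : Finset κ) (B : κ → Set Ω)
    (h : ∀ z ∈ A, ∃ i ∈ s, z ∈ B i) : prob D A ≤ ∑ i ∈ s, prob D (B i) := by
  classical
  unfold prob expect
  rw [Finset.sum_comm]
  refine Finset.sum_le_sum fun z _ => ?_
  rw [← Finset.mul_sum]
  refine mul_le_mul_of_nonneg_left ?_ ENNReal.toReal_nonneg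
  have h0 : ∀ i ∈ s, 0 ≤ (B i).indicator (fun _ => (1 : ℝ)) z :=
    fun i _ => Set.indicator_nonneg (fun _ _ => zero_le_one) z
  by_cases hz : z ∈ A
  · obtain ⟨i, hi, hzi⟩ := h z hz
    rw [Set.indicator_of_mem hz]
    refine le_trans ?_ (Finset.single_le_sum h0 hi)
    rw [Set.indicator_of_mem hzi]
  · rw [Set.indicator_of_notMem hz]
    exact Finset.sum_nonneg h0

open Classical in
theorem prob_uniformOfFintype [Nonempty Ω] (A : Set Ω) :
    prob (PMF.uniformOfFintype Ω) A =
      ((Finset.univ.filter fun z => z ∈ A).card : ℝ) / Fintype.card Ω := by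
  unfold prob expect
  simp only [PMF.uniformOfFintype_apply, ENNReal.toReal_inv, ENNReal.toReal_natCast,
    Set.indicator_apply]
  rw [← Finset.mul_sum, Finset.sum_boole, inv_mul_eq_div]

theorem Fools.prob_le {ι : Type} [Fintype ι] [DecidableEq ι] {D : PMF (ι → Bool)} {ε : ℝ}
    {𝒞 : Set ((ι → Bool) → Bool)} (h : Fools D ε 𝒞) {A : Set (ι → Bool)}
    [DecidablePred fun z => z ∈ A] (hA : (fun z => decide (z ∈ A)) ∈ 𝒞) :
    prob D A ≤ prob (PMF.uniformOfFintype (ι → Bool)) A + ε := by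
  have key : ∀ E : PMF (ι → Bool), prob E A =
      expect E fun x => if decide (x ∈ A) = true then 1 else 0 := by
    intro E
    unfold prob expect
    refine Finset.sum_congr rfl fun x _ => ?_
    by_cases hx : x ∈ A <;> simp [hx]
  have := (abs_sub_le_iff.1 (h _ hA)).1
  rw [key, key]
  linarith

end

/-! ### The two bounds for a fixed sequence of formulas -/

section
variable {n q : ℕ}

/-- The points `(ϱ, y)` under which the segments `w`, and one more, query at least `t` variables of
the formulas `𝓖`. -/
def reachEvent (q t : ℕ) (𝓖 : List (CNF n)) (w : List (Segment n)) :
    Set (EncIndex n q → Bool) :=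
  {z | Reaches (decodeRestriction z) t ⟨𝓖, fun _ => none, fun _ => none⟩ w}

/-- Under the uniform distribution the expected number of lists of segments that occur is small. -/
theorem sum_prob_reachEvent_le {k t : ℕ} (hk : 1 ≤ k) {𝓖 : List (CNF n)}
    (h𝓖 : ∀ F ∈ 𝓖, ∀ C ∈ F, C.length ≤ k) {p : ℝ} (hp : 0 < p) (hq : (2 : ℝ) ^ q = 1 / p)
    (hsmall : 32 * p * k ≤ 1) :
    ∑ w ∈ (Finset.range t).biUnion (segLists n),
        prob (PMF.uniformOfFintype (EncIndex n q → Bool)) (reachEvent q t 𝓖 w) ≤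
      k * (32 * p * k) ^ t := by
  classical
  have hN : (Fintype.card (EncIndex n q → Bool) : ℝ) = 2 ^ (n * q + n) := by
    simp
  have hlive : ∀ T, ((∑ w ∈ segLists n T, (Finset.univ.filter fun z : EncIndex n q → Bool =>
      Along (Live (decodeRestriction z)) ⟨𝓖, fun _ => none, fun _ => none⟩ w).card : ℕ) : ℝ) ≤
      2 ^ (n * q + n) * (32 * p * k) ^ T := by
    intro T
    have h := sum_card_live_mul_le (q := q) hk h𝓖 T
    have h' : ((∑ w ∈ segLists n T, (Finset.univ.filter fun z : EncIndex n q → Bool =>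
        Along (Live (decodeRestriction z)) ⟨𝓖, fun _ => none, fun _ => none⟩ w).card : ℕ) : ℝ) *
        2 ^ (T * q) ≤ 2 ^ (n * q + n) * (24 * k) ^ T := by exact_mod_cast h
    have h2 : (2 : ℝ) ^ (T * q) = (1 / p) ^ T := by rw [mul_comm, pow_mul, hq]
    have hpT : 0 < (1 / p) ^ T := by positivity
    rw [h2, ← le_div_iff₀ hpT] at h'
    refine h'.trans ?_
    rw [mul_div_assoc, ← div_pow]
    have h24 : 24 * (k : ℝ) / (1 / p) ≤ 32 * p * k := by
      rw [div_div_eq_mul_div, div_one]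
      nlinarith [mul_nonneg hp.le (Nat.cast_nonneg (α := ℝ) k)]
    gcongr
  simp only [prob_uniformOfFintype, hN]
  rw [← Finset.sum_div, div_le_iff₀ (by positivity), ← Nat.cast_sum]
  refine (Nat.cast_le.2 (sum_card_reaches_le h𝓖 t)).trans ?_
  rw [Nat.cast_sum]
  calc ∑ T ∈ Finset.Ico t (t + k), _
      ≤ ∑ T ∈ Finset.Ico t (t + k), (2 : ℝ) ^ (n * q + n) * (32 * p * k) ^ t := by
        refine Finset.sum_le_sum fun T hT => (hlive T).trans ?_
        refine mul_le_mul_of_nonneg_left ?_ (by positivity)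
        exact pow_le_pow_of_le_one (by positivity) hsmall (Finset.mem_Ico.1 hT).1
    _ = k * (32 * p * k) ^ t * 2 ^ (n * q + n) := by
        rw [Finset.sum_const, Nat.card_Ico, Nat.add_sub_cancel_left, nsmul_eq_mul]
        ring

/-- The size of the test circuits. In terms of `N = n ^ ℓ` and `H = 2 ^ (k * q)` it is at most
`N ^ 12 * H ^ 2 ≤ N ^ 24 + H ^ 4`. -/
theorem test_size_le {n M Q k ℓ q m : ℕ} (hn : 2 ≤ n) (hM : 1 ≤ M) (hQ : 1 ≤ Q) (hk : 1 ≤ k)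
    (hℓ : k ≤ ℓ) (hq : 1 ≤ q) (hm : m ≤ n) :
    Fintype.card (EncIndex n q) + ((m + 1) * ((2 * n + 3) ^ k + 1) *
        (((2 * n + 3) ^ k + 2) * 2 ^ (k * (q + 1))) + (m + 1) * ((2 * n + 3) ^ k + 1) + 1) ≤
      M * (n ^ (24 * ℓ) + Q * 2 ^ (4 * (k * q))) := by
  have hℓ1 : ℓ ≠ 0 := by omega
  set N := n ^ ℓ with hN
  set H := 2 ^ (k * q) with hH
  have hnN : n ≤ N := Nat.le_self_pow hℓ1 n
  have hN2 : 2 ≤ N := hn.trans hnN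
  have hqH : q + 1 ≤ H := by
    have h1 : q < 2 ^ q := Nat.lt_two_pow_self
    have h2 : 2 ^ q ≤ H := Nat.pow_le_pow_right (by norm_num) (Nat.le_mul_of_pos_left q hk)
    omega
  have hH1 : 1 ≤ H := by omega
  have hm1 : m + 1 ≤ N ^ 2 := by nlinarith
  have hbase : (2 * n + 3) ^ k ≤ N ^ 3 := by
    have h7 : 2 * n + 3 ≤ n ^ 3 := by nlinarith [pow_succ n 2, pow_two n]
    calc (2 * n + 3) ^ k ≤ (n ^ 3) ^ k := Nat.pow_le_pow_left h7 k
      _ = (n ^ k) ^ 3 := pow_right_comm n 3 k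
      _ ≤ N ^ 3 := Nat.pow_le_pow_left (Nat.pow_le_pow_right (by omega) hℓ) 3
  have hN8 : 2 ^ 3 ≤ N ^ 3 := Nat.pow_le_pow_left hN2 3
  have hN4 : N ^ 3 * 2 ≤ N ^ 4 := Nat.mul_le_mul_left _ hN2
  have hterm : 2 ^ (k * (q + 1)) ≤ H ^ 2 := by
    rw [hH, ← pow_mul]
    exact Nat.pow_le_pow_right (by norm_num) (by nlinarith)
  have ha : (m + 1) * ((2 * n + 3) ^ k + 1) ≤ N ^ 6 :=
    (Nat.mul_le_mul hm1 (by omega : (2 * n + 3) ^ k + 1 ≤ N ^ 4)).trans_eq (by ring)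
  have hb : ((2 * n + 3) ^ k + 2) * 2 ^ (k * (q + 1)) ≤ N ^ 4 * H ^ 2 :=
    Nat.mul_le_mul (by omega) hterm
  have hab := Nat.mul_le_mul ha hb
  have hι : Fintype.card (EncIndex n q) ≤ N * H := by
    simp only [Fintype.card_sum, Fintype.card_prod, Fintype.card_fin]
    exact (by ring : n * q + n = n * (q + 1)).trans_le (Nat.mul_le_mul hnN hqH)
  have e1 : N * H ≤ N ^ 10 * H ^ 2 :=
    Nat.mul_le_mul (Nat.le_self_pow (by norm_num) N) (Nat.le_self_pow (by norm_num) H)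
  have e2 : N ^ 6 ≤ N ^ 10 * H ^ 2 :=
    (Nat.pow_le_pow_right (by omega) (by norm_num)).trans
      (Nat.le_mul_of_pos_right _ (pow_pos hH1 2))
  have e3 : 1 ≤ N ^ 10 * H ^ 2 := Nat.mul_pos (pow_pos (by omega) 10) (pow_pos hH1 2)
  have e4 : N ^ 6 * (N ^ 4 * H ^ 2) = N ^ 10 * H ^ 2 := by ring
  have e5 : 4 * (N ^ 10 * H ^ 2) ≤ N ^ 12 * H ^ 2 := by
    have h4 : 2 ^ 2 ≤ N ^ 2 := Nat.pow_le_pow_left hN2 2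
    calc 4 * (N ^ 10 * H ^ 2) ≤ N ^ 2 * (N ^ 10 * H ^ 2) := Nat.mul_le_mul_right _ h4
      _ = N ^ 12 * H ^ 2 := by ring
  have e6 : N ^ 12 * H ^ 2 ≤ N ^ 24 + H ^ 4 := by
    rw [show N ^ 24 = N ^ 12 * N ^ 12 by ring, show H ^ 4 = H ^ 2 * H ^ 2 by ring]
    rcases le_total (N ^ 12) (H ^ 2) with h | h
    · exact (Nat.mul_le_mul_right _ h).trans (Nat.le_add_left _ _)
    · exact (Nat.mul_le_mul_left _ h).trans (Nat.le_add_right _ _)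
  have e7 : N ^ 24 + H ^ 4 ≤ M * (n ^ (24 * ℓ) + Q * 2 ^ (4 * (k * q))) := by
    have h1 : n ^ (24 * ℓ) = N ^ 24 := by rw [hN, ← pow_mul, mul_comm]
    have h2 : 2 ^ (4 * (k * q)) = H ^ 4 := by rw [hH, ← pow_mul, mul_comm]
    rw [h1, h2]
    exact (Nat.add_le_add_left (Nat.le_mul_of_pos_left _ hQ) _).trans (Nat.le_mul_of_pos_left _ hM)
  omega

/-- Each test is decided by a small depth-3 circuit, hence is as likely under `D` as under the
uniform distribution, up to the error `ε`. -/
theorem prob_reachEvent_le {M Q k ℓ t : ℕ} (hn : 2 ≤ n) (hM : 1 ≤ M) (hℓ : k ≤ ℓ) (hq : 1 ≤ q)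
    {𝓖 : List (CNF n)} (h𝓖 : ∀ F ∈ 𝓖, CNF.IsKCNF Q k F) {D : PMF (EncIndex n q → Bool)} {ε : ℝ}
    (hε : 0 ≤ ε)
    (hD : Fools D ε (circuitClass (EncIndex n q) 3 (M * (n ^ (24 * ℓ) + Q * 2 ^ (4 * (k * q))))))
    {w : List (Segment n)} (hw : (∀ s ∈ w, s.1 ≠ []) ∧ segSize w < t) :
    prob D (reachEvent q t 𝓖 w) ≤
      prob (PMF.uniformOfFintype (EncIndex n q → Bool)) (reachEvent q t 𝓖 w) + ε := by
  classical
  have hst : ∀ F ∈ (⟨𝓖, fun _ => none, fun _ => none⟩ : State n).formulas,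
      ∀ C ∈ F, C.length ≤ k := fun F hF => (h𝓖 F hF).2
  rcases (reachEvent q t 𝓖 w).eq_empty_or_nonempty with he | ⟨z, hz⟩
  · have h0 : prob D (reachEvent q t 𝓖 w) = 0 := by
      simp [he, prob, expect]
    rw [h0]
    exact add_nonneg (prob_nonneg _ _) hε
  · have hz' : Reaches (decodeRestriction z) t ⟨𝓖, fun _ => none, fun _ => none⟩ w := hz
    have hfree := (free_of_along_live (fun i => by simp) hz'.1.2).1
    have hm : w.length ≤ n := by
      refine (length_le_segSize hw.1).trans ?_
      rw [← length_segVars]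
      exact hfree.length_le_card.trans_eq (Fintype.card_fin n)
    -- a description that occurs somewhere queries a nonempty clause
    have hk : 1 ≤ k := by
      obtain ⟨s, -, -, h1, h2⟩ := hz'.exists_segment hst
      omega
    have hQ : 1 ≤ Q := by
      obtain ⟨-, -, C, hC, -⟩ := hz'
      obtain ⟨F, hF, E, hE, -⟩ := State.exists_formula_of_firstLive hC
      exact (List.length_pos_of_mem hE).trans_le
        (h𝓖 F (State.mem_formulas_of_mem_next w _ F hF)).1
    refine hD.prob_le (IsAndOrAnd.mem_circuitClass
      ((isAndOrAnd_reaches hw.1 hw.2 hst).congr fun z => ?_)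
      (test_size_le hn hM hQ hk hℓ hq hm))
    rw [decide_eq_true_eq]
    rfl

end

end MultiSwitching

open MultiSwitching in
theorem theorem3 :
    ∃ c₁ c₂ c₃ : ℕ,
      ∀ (n M Q k ℓ t q : ℕ) (δ p : ℝ) (𝓕 : List (MultiSwitching.CNF n)),
        𝓕.length = M →
        (∀ F ∈ 𝓕, MultiSwitching.CNF.IsKCNF Q k F) →
        0 < δ → δ < 1 → 0 < p → p < 1 →
        (q : ℝ) = Real.logb 2 (1 / p) →
        1 ≤ ℓ → k ≤ ℓ →
        ∀ D : PMF (MultiSwitching.EncIndex n q → Bool),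
          MultiSwitching.Fools D
            (δ / ((M : ℝ) ^ ⌈(t : ℝ) / (ℓ : ℝ)⌉₊ * (n : ℝ) ^ (c₁ * t)))
            (MultiSwitching.circuitClass (MultiSwitching.EncIndex n q) 3
              (M * (n ^ (c₂ * ℓ) + Q * 2 ^ (c₃ * (k * q))))) →
          MultiSwitching.prob D
              {z | (t : ℕ∞) ≤ MultiSwitching.ccdtDepth k ℓ
                (𝓕.map (MultiSwitching.CNF.restrict (MultiSwitching.decodeRestriction z)))} ≤
            (16 : ℝ) ^ (t + ℓ) * (M : ℝ) ^ ⌈(t : ℝ) / (ℓ : ℝ)⌉₊ * (32 * p * (k : ℝ)) ^ t + δ := by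
  refine ⟨5, 24, 4, ?_⟩
  intro n M Q k ℓ t q δ p 𝓕 hM h𝓕 hδ _ hp hp1 hq hℓ hkℓ D hD
  classical
  set R := ⌈(t : ℝ) / (ℓ : ℝ)⌉₊ with hR
  set bad : Set (EncIndex n q → Bool) := {z | (t : ℕ∞) ≤ ccdtDepth k ℓ
    (𝓕.map (CNF.restrict (decodeRestriction z)))} with hbad
  have hpk : 0 ≤ 32 * p * (k : ℝ) := by positivity
  rcases Nat.eq_zero_or_pos t with rfl | ht
  · refine (prob_le_one D bad).trans ?_
    have h1 : (1 : ℝ) ≤ 16 ^ (0 + ℓ) := one_le_pow₀ (by norm_num)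
    have hR0 : R = 0 := by simp [hR]
    rw [hR0, pow_zero, pow_zero, mul_one, mul_one]
    linarith
  rcases bad.eq_empty_or_nonempty with he | ⟨z₀, hz₀⟩
  · have h0 : prob D bad = 0 := by simp [he, prob, expect]
    rw [h0]
    positivity
  -- a query is made only along a full path with more than `ℓ ≥ 1` variables
  obtain ⟨hn, hM1⟩ : 2 ≤ n ∧ 1 ≤ M := by
    obtain ⟨T, hT, htT⟩ := exists_isCCDT_of_le_ccdtDepth ht hz₀
    obtain ⟨h1, h2⟩ := hT.lt_of_depth_pos (le_trans ht htT)
    refine ⟨by omega, ?_⟩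
    rw [← hM]
    exact List.length_pos_of_ne_nil fun h => h2 (by rw [h, List.map_nil])
  have hM1' : (1 : ℝ) ≤ M := by exact_mod_cast hM1
  rcases lt_or_ge 1 (32 * p * (k : ℝ)) with hbig | hsmall
  · refine (prob_le_one D bad).trans ?_
    have h1 : (1 : ℝ) ≤ 16 ^ (t + ℓ) := one_le_pow₀ (by norm_num)
    have h2 : (1 : ℝ) ≤ (M : ℝ) ^ R := one_le_pow₀ hM1'
    have h3 : (1 : ℝ) ≤ (32 * p * (k : ℝ)) ^ t := one_le_pow₀ hbig.le
    have h4 := one_le_mul_of_one_le_of_one_le (one_le_mul_of_one_le_of_one_le h1 h2) h3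
    linarith
  have hq2 : (2 : ℝ) ^ q = 1 / p := by
    rw [← Real.rpow_natCast, hq, Real.rpow_logb (by norm_num) (by norm_num) (by positivity)]
  have hq1 : 1 ≤ q := by
    refine Nat.one_le_iff_ne_zero.2 ?_
    rintro rfl
    rw [pow_zero, eq_div_iff hp.ne', one_mul] at hq2
    exact hp1.ne hq2
  have htR : t ≤ R * ℓ := by
    have h1 : (t : ℝ) / ℓ ≤ R := Nat.le_ceil _
    rw [div_le_iff₀ (by exact_mod_cast hℓ)] at h1
    exact_mod_cast h1
  -- the sequence of formulas that are followed, chosen by their numbers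
  let 𝓖 : (Fin R → Fin M) → List (CNF n) := fun I => List.ofFn fun j => 𝓕.get ((I j).cast hM.symm)
  have h𝓖 : ∀ I, ∀ F ∈ 𝓖 I, CNF.IsKCNF Q k F := by
    intro I F hF
    obtain ⟨j, rfl⟩ := (List.mem_ofFn' _ _).1 hF
    exact h𝓕 _ (List.get_mem _ _)
  set W : Finset (List (Segment n)) := (Finset.range t).biUnion (segLists n) with hW
  have hmemW : ∀ w, w ∈ W ↔ (∀ s ∈ w, s.1 ≠ []) ∧ segSize w < t := by
    intro w
    simp only [hW, Finset.mem_biUnion, Finset.mem_range, mem_segLists]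
    exact ⟨fun ⟨T, hT, h1, h2⟩ => ⟨h1, h2 ▸ hT⟩, fun ⟨h1, h2⟩ => ⟨_, h2, h1, rfl⟩⟩
  have hcover : ∀ z ∈ bad, ∃ a ∈ (Finset.univ : Finset (Fin R → Fin M)) ×ˢ W,
      z ∈ reachEvent q t (𝓖 a.1) a.2 := by
    intro z hz
    obtain ⟨T, hT, htT⟩ := exists_isCCDT_of_le_ccdtDepth ht hz
    obtain ⟨𝓖', h1, h2, w, hw⟩ := exists_reaches_of_isCCDT hT (decodeRestriction z) 𝓕
      (fun _ => none) t R (by rw [extend_none]) ht htT htR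
    have hidx : ∀ j : Fin R, ∃ i : Fin M, 𝓕.get (i.cast hM.symm) = 𝓖'.get (j.cast h1.symm) := by
      intro j
      obtain ⟨i, hi⟩ := List.mem_iff_get.1 (h2 _ (List.get_mem 𝓖' (j.cast h1.symm)))
      exact ⟨i.cast hM, hi⟩
    choose I hI using hidx
    have h𝓖' : 𝓖 I = 𝓖' := by
      refine List.ext_getElem (by simp [𝓖, h1]) fun j hj hj' => ?_
      simpa [𝓖] using hI ⟨j, h1 ▸ hj'⟩
    exact ⟨(I, w), Finset.mem_product.2 ⟨Finset.mem_univ _, (hmemW w).2 ⟨hw.1.1, hw.2.1⟩⟩,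
      by rw [h𝓖']; exact hw⟩
  set ε : ℝ := δ / ((M : ℝ) ^ R * (n : ℝ) ^ (5 * t)) with hε
  have hε0 : 0 ≤ ε := by positivity
  have hWε : W.card * ε ≤ δ / (M : ℝ) ^ R := by
    have h1 : (W.card : ℝ) ≤ (n : ℝ) ^ (5 * t) := by
      exact_mod_cast card_biUnion_segLists_le hn
    have h2 : (0 : ℝ) < (n : ℝ) ^ (5 * t) := by positivity
    calc W.card * ε ≤ (n : ℝ) ^ (5 * t) * ε := mul_le_mul_of_nonneg_right h1 hε0
      _ = δ / (M : ℝ) ^ R := by rw [hε]; field_simp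
  have hk1 : 1 ≤ k := by
    obtain ⟨a, -, ha⟩ := hcover z₀ hz₀
    obtain ⟨s, -, -, h1, h2⟩ := Reaches.exists_segment (fun F hF => (h𝓖 a.1 F hF).2) ha
    have := ha.2.1
    omega
  have hI : ∀ I, ∑ w ∈ W, prob D (reachEvent q t (𝓖 I) w) ≤
      k * (32 * p * k) ^ t + δ / (M : ℝ) ^ R := by
    intro I
    calc ∑ w ∈ W, prob D (reachEvent q t (𝓖 I) w)
        ≤ ∑ w ∈ W, (prob (PMF.uniformOfFintype _) (reachEvent q t (𝓖 I) w) + ε) :=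
          Finset.sum_le_sum fun w hw =>
            prob_reachEvent_le hn hM1 hkℓ hq1 (h𝓖 I) hε0 hD ((hmemW w).1 hw)
      _ ≤ k * (32 * p * k) ^ t + δ / (M : ℝ) ^ R := by
          rw [Finset.sum_add_distrib, Finset.sum_const, nsmul_eq_mul]
          exact add_le_add
            (sum_prob_reachEvent_le hk1 (fun F hF => (h𝓖 I F hF).2) hp hq2 hsmall) hWε
  have hk16 : (k : ℝ) ≤ 16 ^ (t + ℓ) := by
    have h1 : k < 16 ^ (t + ℓ) := (by omega : k ≤ t + ℓ).trans_lt (Nat.lt_pow_self (by norm_num))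
    exact_mod_cast h1.le
  calc prob D bad
      ≤ ∑ a ∈ (Finset.univ : Finset (Fin R → Fin M)) ×ˢ W,
          prob D (reachEvent q t (𝓖 a.1) a.2) := prob_le_sum D _ _ hcover
    _ = ∑ I : Fin R → Fin M, ∑ w ∈ W, prob D (reachEvent q t (𝓖 I) w) :=
        Finset.sum_product ..
    _ ≤ ∑ _I : Fin R → Fin M, (k * (32 * p * k) ^ t + δ / (M : ℝ) ^ R) :=
        Finset.sum_le_sum fun I _ => hI I
    _ = k * (M : ℝ) ^ R * (32 * p * k) ^ t + δ := by
        rw [Finset.sum_const, Finset.card_univ, Fintype.card_fun, Fintype.card_fin,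
          Fintype.card_fin, nsmul_eq_mul, Nat.cast_pow]
        have : (M : ℝ) ^ R ≠ 0 := by positivity
        field_simp
    _ ≤ 16 ^ (t + ℓ) * (M : ℝ) ^ R * (32 * p * k) ^ t + δ := by gcongr
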